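/- Let $k$ be a field, let $A$ be an associative unital $k$-algebra that is a prime Goldie ring (Goldie on both sides), and let $G$ be a finite group of $k$-algebra automorphisms of $A$. Suppose that $G$ has nondegenerate trace on $A$, that is, for every nonzero left ideal $I$ and every nonzero right ideal $I$ of $A$ there is $a \in I$ with $\sum_{g \in G} g(a) \neq 0$; or suppose that $A$ has no nonzero nilpotent elements. Suppose also that the subalgebra of invariants $B = A^G$ is a prime Goldie ring. Then $$\mathrm{LD}\, A = \mathrm{LD}\, B,$$ and if $\mathrm{LD}\, A = \mathrm{GK}\, A$ (that is, $A$ is LD-stable), then $\mathrm{LD}\, B = \mathrm{GK}\, B$ (that is, $B$ is LD-stable). Here, for a $k$-algebra $R$, a subframe of $R$ is a finite-dimensional $k$-subspace $V \subseteq R$ with $1 \in V$. The Gelfand-Kirillov dimension is $\mathrm{GK}\, R = \sup_V \limsup_{n \to \infty} \frac{\log \dim_k V^n}{\log n}$, with $V$ running over all subframes. For real $d > 0$, a subframe $V$ satisfies $\mathrm{VDI}(R)_d$ if there is a real $c > 0$ such that $\dim VW \geq \dim W + c\,(\dim W)^{(d-1)/d}$ for every nonzero finite-dimensional subspace $W \subseteq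 R$, and it satisfies $\mathrm{VDI}(R)_\infty$ if there is a real $c > 0$ such that $\dim VW \geq \dim W + c \dim W$ for all such $W$. The lower transcendence degree $\mathrm{LD}\, R \in [0, \infty]$ is the supremum of all $d \in (0, \infty]$ such that some subframe of $R$ satisfies $\mathrm{VDI}(R)_d$, and it is $0$ if there is no such $d$. -/

import Mathlib

open scoped ENNReal

/-- A (nonzero) ring is prime if `a R b = 0` forces `a = 0` or `b = 0`. -/
structure IsPrimeRing (R : Type*) [Ring R] : Prop where
  nontrivial : Nontrivial R
  eq_zero_or_eq_zero : ∀ a b : R, (∀ r : R, a * r * b = 0) → a = 0 ∨ b = 0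

/-- The left annihilator of a subset. -/
def leftAnn {R : Type*} [Ring R] (S : Set R) : Set R := {x | ∀ s ∈ S, x * s = 0}

/-- The right annihilator of a subset. -/
def rightAnn {R : Type*} [Ring R] (S : Set R) : Set R := {x | ∀ s ∈ S, s * x = 0}

/-- Left Goldie: the ascending chain condition on left annihilators, and no infinite direct sum of
nonzero left ideals. -/
structure IsLeftGoldie (R : Type*) [Ring R] : Prop where
  acc : ∀ S : ℕ → Set R, Monotone (fun n => leftAnn (S n)) →
    ∃ n, ∀ m, n ≤ m → leftAnn (S m) = leftAnn (S n)
  finite_dim : ¬ ∃ I : ℕ → Submodule R R, (∀ n, I n ≠ ⊥) ∧ iSupIndep I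

/-- Right Goldie; right ideals are the submodules for the opposite ring. -/
structure IsRightGoldie (R : Type*) [Ring R] : Prop where
  acc : ∀ S : ℕ → Set R, Monotone (fun n => rightAnn (S n)) →
    ∃ n, ∀ m, n ≤ m → rightAnn (S m) = rightAnn (S n)
  finite_dim : ¬ ∃ I : ℕ → Submodule Rᵐᵒᵖ R, (∀ n, I n ≠ ⊥) ∧ iSupIndep I

/-- A prime Goldie ring: prime, and Goldie on both sides. -/
structure IsPrimeGoldie (R : Type*) [Ring R] : Prop where
  prime : IsPrimeRing R
  left : IsLeftGoldie R
  right : IsRightGoldie R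

section Invariants

variable (k : Type*) [Field k] (A : Type*) [Ring A] [Algebra k A]

/-- Subframes: finite-dimensional subspaces containing the unit. -/
def IsSubframe (V : Submodule k A) : Prop := Module.Finite k V ∧ (1 : A) ∈ V

/-- The Gelfand-Kirillov dimension
`sup_V limsup_n log (dim V ^ n) / log n`, where `V` runs over the subframes. -/
noncomputable def GKdim : ℝ≥0∞ :=
  ⨆ (V : Submodule k A) (_ : IsSubframe k A V),
    Filter.limsup (fun n : ℕ =>
      ENNReal.ofReal (Real.log (Module.finrank k (V ^ n : Submodule k A)) / Real.log n))
      Filter.atTop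

/-- The volume difference inequality `VDI(A)_d` for `V`, with `0 < d < ∞` real: there is `c > 0`
with `dim VW ≥ dim W + c (dim W) ^ ((d - 1) / d)` for all finite-dimensional `W ≠ 0`. -/
def VDI (V : Submodule k A) (d : ℝ) : Prop :=
  ∃ c : ℝ, 0 < c ∧ ∀ W : Submodule k A, Module.Finite k W → W ≠ ⊥ →
    (Module.finrank k W : ℝ) + c * (Module.finrank k W : ℝ) ^ ((d - 1) / d) ≤
      (Module.finrank k (V * W : Submodule k A) : ℝ)

/-- The volume difference inequality `VDI(A)_∞` for `V`. -/
def VDITop (V : Submodule k A) : Prop :=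
  ∃ c : ℝ, 0 < c ∧ ∀ W : Submodule k A, Module.Finite k W → W ≠ ⊥ →
    (Module.finrank k W : ℝ) + c * (Module.finrank k W : ℝ) ≤
      (Module.finrank k (V * W : Submodule k A) : ℝ)

/-- The set of all `d ∈ (0, ∞]` such that some subframe of `A` satisfies `VDI(A)_d`. -/
def VDISet : Set ℝ≥0∞ :=
  {e | ∃ V : Submodule k A, IsSubframe k A V ∧
    ((∃ d : ℝ, 0 < d ∧ VDI k A V d ∧ e = ENNReal.ofReal d) ∨ (VDITop k A V ∧ e = ⊤))}

/-- The lower transcendence degree. The supremum of the empty set is `0` in `[0, ∞]`, and the set is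
empty in the case in which the degree is declared to be `0`, see `LD_eq_zero`. -/
noncomputable def LD : ℝ≥0∞ := sSup (VDISet k A)

/-- If for every subframe `V` there is a finite-dimensional `W ≠ 0` with `dim VW = dim W`, then the
lower transcendence degree is `0`. -/
theorem LD_eq_zero
    (h : ∀ V : Submodule k A, IsSubframe k A V → ∃ W : Submodule k A, Module.Finite k W ∧ W ≠ ⊥ ∧
      Module.finrank k (V * W : Submodule k A) = Module.finrank k W) :
    LD k A = 0 := by
  have hE : VDISet k A = ∅ := by
    ext e
    simp only [Set.mem_empty_iff_false, iff_false]
    rintro ⟨V, hV, hd⟩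
    obtain ⟨W, hW, hW0, hdim⟩ := h V hV
    have hpos : (0 : ℝ) < Module.finrank k W := by
      have : Nontrivial W := (Submodule.nontrivial_iff_ne_bot).2 hW0
      exact_mod_cast Module.finrank_pos
    rcases hd with ⟨d, _, ⟨c, hc, H⟩, _⟩ | ⟨⟨c, hc, H⟩, _⟩
    · have h1 := H W hW hW0
      have h2 := mul_pos hc (Real.rpow_pos_of_pos hpos ((d - 1) / d))
      rw [hdim] at h1
      linarith
    · have h1 := H W hW hW0
      have h2 := mul_pos hc hpos
      rw [hdim] at h1
      linarith
  simp [LD, hE]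

/-- `A` is LD-stable if its lower transcendence degree equals its Gelfand-Kirillov dimension. -/
def IsLDStable : Prop := LD k A = GKdim k A

end Invariants

/-- A finite group `G` of automorphisms of `A` has nondegenerate trace if the trace
`a ↦ ∑ g ∈ G, g a` vanishes identically on no nonzero one-sided ideal of `A`. -/
def HasNondegenerateTrace (k : Type*) [Field k] (A : Type*) [Ring A] [Algebra k A]
    (G : Subgroup (A ≃ₐ[k] A)) [Fintype G] : Prop :=
  (∀ I : Submodule A A, I ≠ ⊥ → ∃ a ∈ I, ∑ g : G, (g : A ≃ₐ[k] A) a ≠ 0) ∧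
  (∀ I : Submodule Aᵐᵒᵖ A, I ≠ ⊥ → ∃ a ∈ I, ∑ g : G, (g : A ≃ₐ[k] A) a ≠ 0)

/-!
The theorem is reduced to two embeddings of `A` into free modules over the invariants `B = A ^ G`,
one of left modules and one of right modules, both of finite rank (`HasInvariantForms`).

*Embeddings.* If the trace is nondegenerate, the maps `y ↦ tr (y x)` are left linear over `B` and
jointly injective, and finitely many of them are already jointly injective: the vectors
`(g x)_g` lie in a module of finite uniform dimension, so that finitely many of them span a dense
submodule, and prime Goldie rings are nonsingular
(`IsPrimeLeftGoldie.exists_finset_annihilating`). If `A` is reduced, then it is an Ore domain, and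
its trace may vanish identically. Here `G` acts on the division ring of fractions `D`, which by
Artin's lemma has finite dimension over `D ^ G`, the coordinate functionals of `D` over `D ^ G` are
combinations of the elements of `G` (`exists_coordinates`), and their denominators can be cleared by
an invariant (`exists_invariant_mem_mul`). The right-handed embedding is obtained from the opposite
ring.

*The inequality `LD B ≤ LD A`.* Volume inequalities pass to finite powers of a module and to
submodules (`VolumeInequality.pi_fin`, `VolumeInequality.of_injective`). Hence a subframe of `B`
satisfies the same inequalities, with smaller constants, on the left `B`-module `A`.

*The inequality `LD A ≤ LD B`.* The right `B`-module `A` embeds in a free module of finite rank, so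
that some power of `A` contains a dense free right `B`-module with finite basis `e`
(`IsPrimeLeftGoldie.exists_free_dense`). By the argument of Goldie's theorem the dense module
absorbs finitely many vectors after right multiplication by one left regular element `s` of `B`.
Thus for a subframe `V` of `A` there is a subframe `V'` of `B` with
`V (∑ e j s W) ⊆ ∑ e j V' W` for all `W ⊆ B`. As `e` is free, dimensions on both sides are multiples
of those of `W` and `V' W` by the same integer, and the volume inequality for `V` on the power of
`A` becomes one for `V'` on `B` (`LD_le_of_free_dense`).

*Stability.* The Gelfand-Kirillov dimension is monotone for subalgebras, and it bounds the lower
transcendence degree from above (`LD_le_GKdim`), so that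
`GK B ≤ GK A = LD A = LD B ≤ GK B`.
-/

/-! ### Modules of finite uniform dimension -/

/-- A module has finite uniform dimension if it contains no infinite direct sum of nonzero
submodules. The definition speaks of a sequence of nonzero elements `p n`: for some `n` the cyclic
submodule of `p n` meets the span of the preceding terms nontrivially. -/
def FiniteUniformDim (S M : Type*) [Ring S] [AddCommGroup M] [Module S M] : Prop :=
  ∀ p : ℕ → M, (∀ n, p n ≠ 0) →
    ∃ n, ∃ x : S, x • p n ≠ 0 ∧ x • p n ∈ Submodule.span S (p '' Set.Iio n)

section Modules

variable {S M N : Type*} [Ring S] [AddCommGroup M] [Module S M] [AddCommGroup N] [Module S N]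

theorem sum_range_mem_span_image_Iio (p : ℕ → M) (r : ℕ → S) (n : ℕ) :
    ∑ i ∈ Finset.range n, r i • p i ∈ Submodule.span S (p '' Set.Iio n) :=
  Submodule.sum_mem _ fun i hi => Submodule.smul_mem _ _
    (Submodule.subset_span ⟨i, Finset.mem_range.1 hi, rfl⟩)

theorem exists_eq_sum_range_of_mem_span_image_Iio {p : ℕ → M} {n : ℕ} {z : M}
    (hz : z ∈ Submodule.span S (p '' Set.Iio n)) :
    ∃ r : ℕ → S, z = ∑ i ∈ Finset.range n, r i • p i := by
  induction hz using Submodule.span_induction with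
  | mem z hz =>
    obtain ⟨i, hi, rfl⟩ := hz
    refine ⟨Pi.single i 1, ?_⟩
    rw [Finset.sum_eq_single i] <;> simp +contextual
    intro h; exact absurd (Set.mem_Iio.1 hi) (by omega)
  | zero => exact ⟨0, by simp⟩
  | add u v _ _ hu hv =>
    obtain ⟨r, rfl⟩ := hu
    obtain ⟨s, rfl⟩ := hv
    exact ⟨r + s, by simp [add_smul, Finset.sum_add_distrib]⟩
  | smul a u _ hu =>
    obtain ⟨r, rfl⟩ := hu
    exact ⟨fun i => a * r i, by simp [Finset.smul_sum, mul_smul]⟩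

/-- If the cyclic submodule of each term of a sequence meets the span of the preceding terms
trivially, then the cyclic submodules of all terms form a direct sum. -/
theorem smul_eq_zero_of_sum_range_eq_zero {p : ℕ → M} {n : ℕ}
    (hp : ∀ i < n, ∀ x : S, x • p i ∈ Submodule.span S (p '' Set.Iio i) → x • p i = 0)
    (r : ℕ → S) (h : ∑ i ∈ Finset.range n, r i • p i = 0) : ∀ i < n, r i • p i = 0 := by
  induction n with
  | zero => intro i hi; omega
  | succ n ih =>
    rw [Finset.sum_range_succ] at h
    have h1 : r n • p n = 0 := by
      apply hp n (Nat.lt_succ_self n)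
      rw [eq_neg_of_add_eq_zero_right h]
      exact Submodule.neg_mem _ (sum_range_mem_span_image_Iio p r n)
    rw [h1, add_zero] at h
    intro i hi
    rcases Nat.lt_succ_iff_lt_or_eq.1 hi with hi | rfl
    · exact ih (fun i hi => hp i (by omega)) h i hi
    · exact h1

theorem FiniteUniformDim.of_not_exists
    (h : ¬ ∃ I : ℕ → Submodule S M, (∀ n, I n ≠ ⊥) ∧ iSupIndep I) : FiniteUniformDim S M := by
  intro p hp
  by_contra! hcon
  refine h ⟨fun n => Submodule.span S {p n}, fun n => by simpa using hp n, ?_⟩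
  rw [iSupIndep_iff_finsetSum_eq_zero_imp_eq_zero]
  intro s v hv hsum i hi
  choose! r hr using fun i (hi : i ∈ s) => Submodule.mem_span_singleton.1 (hv i hi)
  classical
  have hn : ∀ i ∈ s, i < s.sup id + 1 := fun i hi => Nat.lt_succ_of_le (Finset.le_sup (f := id) hi)
  have key := smul_eq_zero_of_sum_range_eq_zero (p := p) (n := s.sup id + 1)
    (fun i _ x hx => by_contra fun h0 => hcon i x h0 hx) (fun i => if i ∈ s then r i else 0) (by
      have : ∑ j ∈ Finset.range (s.sup id + 1), (if j ∈ s then r j else 0) • p j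
          = ∑ j ∈ s, r j • p j := by
        rw [← Finset.sum_subset (s₁ := s) (fun i hi => Finset.mem_range.2 (hn i hi))]
        · exact Finset.sum_congr rfl fun j hj => by simp [hj]
        · intro j _ hj; simp [hj]
      rw [this, Finset.sum_congr rfl hr, hsum]) i (hn i hi)
  simp only [hi, if_true] at key
  rw [← hr i hi, key]

theorem FiniteUniformDim.of_injective (f : M →ₗ[S] N) (hf : Function.Injective f)
    (h : FiniteUniformDim S N) : FiniteUniformDim S M := by
  intro p hp
  obtain ⟨n, x, h0, hx⟩ := h (fun n => f (p n)) fun n => by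
    rw [Ne, map_eq_zero_iff f hf]; exact hp n
  refine ⟨n, x, fun h1 => h0 (by rw [← map_smul, h1, map_zero]), ?_⟩
  have : (fun n => f (p n)) '' Set.Iio n = f '' (p '' Set.Iio n) := by rw [Set.image_image]
  rw [this, Submodule.span_image, ← map_smul] at hx
  obtain ⟨y, hy, hyx⟩ := hx
  rwa [← hf hyx]

/-- Blocks of an independent sequence are disjoint. -/
theorem eq_zero_of_mem_span_Iio_of_mem_span_Ico {p : ℕ → M}
    (hp : ∀ i, ∀ x : S, x • p i ∈ Submodule.span S (p '' Set.Iio i) → x • p i = 0) {k l : ℕ} {y : M}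
    (h1 : y ∈ Submodule.span S (p '' Set.Iio k)) (h2 : y ∈ Submodule.span S (p '' Set.Ico k l)) :
    y = 0 := by
  induction l generalizing y with
  | zero => simpa using h2
  | succ l ih =>
    rcases lt_or_ge l k with hl | hl
    · rw [Set.Ico_eq_empty (by omega)] at h2
      simpa using h2
    · have hI : Set.Ico k (l + 1) = insert l (Set.Ico k l) := by
        ext i; simp only [Set.mem_Ico, Set.mem_insert_iff]; omega
      rw [hI, Set.image_insert_eq, Submodule.mem_span_insert] at h2
      obtain ⟨x, u, hu, rfl⟩ := h2
      have hx : x • p l = 0 := by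
        apply hp
        have hu' : u ∈ Submodule.span S (p '' Set.Iio l) :=
          Submodule.span_mono (Set.image_mono fun i hi => hi.2) hu
        have hy' := Submodule.span_mono (Set.image_mono (Set.Iio_subset_Iio hl)) h1
        simpa using Submodule.sub_mem _ hy' hu'
      rw [hx, zero_add] at h1 ⊢
      exact ih h1 hu

/-- An extension of modules of finite uniform dimension has finite uniform dimension. Given an
independent sequence in `M`, either some tail of it spans a submodule meeting `ker f` trivially, and
its image in `N` is independent, or one picks nonzero elements of `ker f` in the spans of
consecutive blocks. -/
theorem FiniteUniformDim.of_ker (f : M →ₗ[S] N) (hN : FiniteUniformDim S N)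
    (hK : FiniteUniformDim S (LinearMap.ker f)) : FiniteUniformDim S M := by
  intro p hp0
  by_contra! hcon
  have hp : ∀ i, ∀ x : S, x • p i ∈ Submodule.span S (p '' Set.Iio i) → x • p i = 0 :=
    fun i x hx => by_contra fun h0 => hcon i x h0 hx
  by_cases hcase : ∃ k, ∀ z ∈ Submodule.span S (p '' Set.Ici k), f z = 0 → z = 0
  · obtain ⟨k, hk⟩ := hcase
    have hmem : ∀ n, p (k + n) ∈ Submodule.span S (p '' Set.Ici k) := fun n =>
      Submodule.subset_span ⟨k + n, by simp, rfl⟩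
    obtain ⟨n, x, h0, hx⟩ := hN (fun n => f (p (k + n))) fun n hn =>
      hp0 _ (hk _ (hmem n) hn)
    have himg : (fun n => f (p (k + n))) '' Set.Iio n
        = f '' ((fun n => p (k + n)) '' Set.Iio n) := by rw [Set.image_image]
    rw [himg, Submodule.span_image, ← map_smul] at hx
    obtain ⟨y, hy, hyx⟩ := hx
    have hy1 : y ∈ Submodule.span S (p '' Set.Ici k) := by
      refine Submodule.span_mono ?_ hy
      rintro _ ⟨i, _, rfl⟩; exact ⟨k + i, by simp, rfl⟩
    have hy2 : y ∈ Submodule.span S (p '' Set.Iio (k + n)) := by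
      refine Submodule.span_mono ?_ hy
      rintro _ ⟨i, hi, rfl⟩; exact ⟨k + i, by simpa using hi, rfl⟩
    have heq : x • p (k + n) = y := by
      refine sub_eq_zero.1 (hk _ (Submodule.sub_mem _ (Submodule.smul_mem _ _ (hmem n)) hy1) ?_)
      rw [map_sub, hyx, sub_self]
    apply h0
    rw [← map_smul, hp _ x (heq ▸ hy2), map_zero]
  · push Not at hcase
    have hblock : ∀ k, ∃ l, ∃ z ∈ Submodule.span S (p '' Set.Ico k l), k ≤ l ∧ f z = 0 ∧ z ≠ 0 := by
      intro k
      obtain ⟨z, hz, hfz, hz0⟩ := hcase k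
      obtain ⟨t, ht, hzt⟩ := Submodule.mem_span_finite_of_mem_span hz
      classical
      choose! i hi using fun y (hy : y ∈ t) => ht hy
      refine ⟨max k (t.sup i + 1), z, Submodule.span_mono ?_ hzt, le_max_left _ _, hfz, hz0⟩
      intro y hy
      refine ⟨i y, ⟨(hi y hy).1, lt_max_of_lt_right (Nat.lt_succ_of_le ?_)⟩, (hi y hy).2⟩
      exact Finset.le_sup (f := i) hy
    choose l z hz hl hfz hz0 using hblock
    let a : ℕ → ℕ := fun n => Nat.rec 0 (fun _ k => l k) n
    have ha : ∀ n, a (n + 1) = l (a n) := fun n => rfl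
    have hmono : Monotone a := monotone_nat_of_le_succ fun n => by rw [ha]; exact hl _
    obtain ⟨n, x, h0, hx⟩ := hK (fun n => ⟨z (a n), hfz (a n)⟩) fun n h =>
      hz0 _ (congrArg Subtype.val h)
    apply h0
    have hx' : x • z (a n) ∈ Submodule.span S (p '' Set.Iio (a n)) := by
      have h1 := Submodule.mem_map_of_mem (f := (LinearMap.ker f).subtype) hx
      rw [← Submodule.span_image, Set.image_image] at h1
      refine Submodule.span_le.2 ?_ h1
      rintro _ ⟨i, hi, rfl⟩
      refine Submodule.span_mono (Set.image_mono ?_) (hz (a i))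
      intro j hj
      exact lt_of_lt_of_le hj.2 (by rw [← ha]; exact hmono hi)
    exact Subtype.ext (eq_zero_of_mem_span_Iio_of_mem_span_Ico hp hx'
      (Submodule.smul_mem _ _ (hz (a n))))

theorem FiniteUniformDim.pi_fin (h : FiniteUniformDim S M) (n : ℕ) :
    FiniteUniformDim S (Fin n → M) := by
  induction n with
  | zero => intro p hp; exact absurd (Subsingleton.elim _ _) (hp 0)
  | succ n ih =>
    refine FiniteUniformDim.of_ker (LinearMap.proj (Fin.last n)) h ?_
    refine FiniteUniformDim.of_injective
      ((LinearMap.funLeft S M (Fin.castSucc (n := n))).comp (Submodule.subtype _)) ?_ ih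
    rw [← LinearMap.ker_eq_bot, LinearMap.ker_eq_bot']
    rintro ⟨v, hv⟩ hv0
    ext i
    refine Fin.lastCases ?_ (fun i => ?_) i
    · exact hv
    · exact congrFun hv0 i

theorem FiniteUniformDim.pi {ι : Type*} [Finite ι] (h : FiniteUniformDim S M) :
    FiniteUniformDim S (ι → M) :=
  (h.pi_fin (Nat.card ι)).of_injective
    (LinearEquiv.funCongrLeft S M (Finite.equivFin ι).symm).toLinearMap
    (LinearEquiv.injective _)

/-- A maximal independent family among the elements with a given property. -/
theorem FiniteUniformDim.exists_maximal_family (h : FiniteUniformDim S M) (P : M → Prop) :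
    ∃ (n : ℕ) (p : Fin n → M), (∀ i, P (p i)) ∧
      (∀ r : Fin n → S, ∑ i, r i • p i = 0 → ∀ i, r i • p i = 0) ∧
      ∀ m, P m → m ≠ 0 → ∃ x : S, x • m ≠ 0 ∧ x • m ∈ Submodule.span S (Set.range p) := by
  classical
  let good (X : Set M) (m : M) : Prop :=
    P m ∧ m ≠ 0 ∧ ∀ x : S, x • m ∈ Submodule.span S X → x • m = 0
  let next (X : Set M) : M := if hX : ∃ m, good X m then hX.choose else 0
  let X : ℕ → Set M := fun n => Nat.rec ∅ (fun _ X => insert (next X) X) n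
  let p : ℕ → M := fun n => next (X n)
  have hX : ∀ n, X n = p '' Set.Iio n := by
    intro n
    induction n with
    | zero => simp [X]
    | succ n ih =>
      have : Set.Iio (n + 1) = insert n (Set.Iio n) := by ext i; simp
      rw [this, Set.image_insert_eq, ← ih]
  have hgood : ∀ n, (∃ m, good (X n) m) → good (X n) (p n) := by
    intro n hn
    have : p n = hn.choose := dif_pos hn
    rw [this]; exact hn.choose_spec
  have hex : ∃ n, ¬ ∃ m, good (X n) m := by
    by_contra! hcon
    obtain ⟨n, x, h0, hx⟩ := h p fun n => (hgood n (hcon n)).2.1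
    rw [← hX] at hx
    exact h0 ((hgood n (hcon n)).2.2 x hx)
  let n := Nat.find hex
  have hlt : ∀ i < n, good (X i) (p i) := fun i hi => hgood i (not_not.1 (Nat.find_min hex hi))
  have hr : Set.range (fun i : Fin n => p i) = X n := by
    rw [hX]; ext y; constructor
    · rintro ⟨i, rfl⟩; exact ⟨i, i.2, rfl⟩
    · rintro ⟨i, hi, rfl⟩; exact ⟨⟨i, hi⟩, rfl⟩
  refine ⟨n, fun i => p i, fun i => (hlt i i.2).1, ?_, ?_⟩
  · intro r hr0 i
    have := smul_eq_zero_of_sum_range_eq_zero (p := p) (n := n)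
      (fun i hi x hx => (hlt i hi).2.2 x (by rwa [hX]))
      (fun i => if hi : i < n then r ⟨i, hi⟩ else 0) (by
        rw [Finset.sum_range]; simpa using hr0) i i.2
    simpa using this
  · intro m hm hm0
    by_contra! hcon
    refine Nat.find_spec hex ⟨m, hm, hm0, fun x hx => by_contra fun h0 => hcon x h0 ?_⟩
    rwa [hr]

end Modules

/-! ### Prime left Goldie rings -/

/-- A prime ring of finite left uniform dimension with the ascending chain condition on left
annihilators of single elements. This is all that the argument uses of the left Goldie condition,
and in this form it passes to opposite rings by inspection. -/
structure IsPrimeLeftGoldie (S : Type*) [Ring S] : Prop where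
  prime : IsPrimeRing S
  acc : ∀ c : ℕ → S, (∀ n x, x * c n = 0 → x * c (n + 1) = 0) →
    ∃ n, ∀ m ≥ n, ∀ x, x * c m = 0 → x * c n = 0
  fud : FiniteUniformDim S S

theorem IsPrimeRing.op {R : Type*} [Ring R] (h : IsPrimeRing R) : IsPrimeRing Rᵐᵒᵖ where
  nontrivial := have := h.nontrivial; inferInstance
  eq_zero_or_eq_zero a b hab := by
    rcases h.eq_zero_or_eq_zero b.unop a.unop fun r => by
      have := congrArg MulOpposite.unop (hab (MulOpposite.op r))
      simpa [mul_assoc] using this with h | h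
    · exact Or.inr (MulOpposite.unop_injective h)
    · exact Or.inl (MulOpposite.unop_injective h)

theorem IsPrimeGoldie.isPrimeLeftGoldie {R : Type*} [Ring R] (h : IsPrimeGoldie R) :
    IsPrimeLeftGoldie R where
  prime := h.prime
  acc c hc := by
    obtain ⟨n, hn⟩ := h.left.acc (fun n => {c n}) (monotone_nat_of_le_succ fun n x hx => by
      simp only [leftAnn, Set.mem_singleton_iff, forall_eq, Set.mem_ofPred_eq] at hx ⊢
      exact hc n x hx)
    refine ⟨n, fun m hm x hx => ?_⟩
    have := hn m hm
    simp only [leftAnn, Set.mem_singleton_iff, forall_eq] at this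
    exact (Set.ext_iff.1 this x).1 hx
  fud := .of_not_exists h.left.finite_dim

theorem IsPrimeGoldie.isPrimeLeftGoldie_op {R : Type*} [Ring R] (h : IsPrimeGoldie R) :
    IsPrimeLeftGoldie Rᵐᵒᵖ where
  prime := h.prime.op
  acc c hc := by
    obtain ⟨n, hn⟩ := h.right.acc (fun n => {(c n).unop})
      (monotone_nat_of_le_succ fun n x hx => by
        simp only [rightAnn, Set.mem_singleton_iff, forall_eq, Set.mem_ofPred_eq] at hx ⊢
        exact MulOpposite.op_injective (hc n (.op x) (MulOpposite.unop_injective hx)))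
    refine ⟨n, fun m hm x hx => ?_⟩
    have := hn m hm
    simp only [rightAnn, Set.mem_singleton_iff, forall_eq] at this
    exact MulOpposite.unop_injective
      ((Set.ext_iff.1 this x.unop).1 (congrArg MulOpposite.unop hx))
  fud := (FiniteUniformDim.of_not_exists h.right.finite_dim).of_injective
    (MulOpposite.opLinearEquiv Rᵐᵒᵖ (M := R)).symm.toLinearMap (LinearEquiv.injective _)

/-- A left ideal is essential if it meets every nonzero cyclic left ideal nontrivially. -/
def IsEssentialLeftIdeal {S : Type*} [Ring S] (J : Submodule S S) : Prop :=
  ∀ a : S, a ≠ 0 → ∃ x, x * a ≠ 0 ∧ x * a ∈ J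

namespace IsPrimeLeftGoldie

variable {S : Type*} [Ring S] (hS : IsPrimeLeftGoldie S)
include hS

/-- Every nonempty set of elements has a member whose left annihilator is maximal. -/
theorem exists_maximal_annihilator {T : Set S} (hT : T.Nonempty) :
    ∃ c ∈ T, ∀ d ∈ T, (∀ x, x * c = 0 → x * d = 0) → ∀ x, x * d = 0 → x * c = 0 := by
  by_contra! hcon
  choose! f hfT hf hx using hcon
  choose! x hx0 hx1 using hx
  obtain ⟨c, hc⟩ := hT
  let s : ℕ → S := fun n => f^[n] c
  have hs : ∀ n, s n ∈ T := by
    intro n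
    induction n with
    | zero => exact hc
    | succ n ih => simp only [s, Function.iterate_succ_apply'] at ih ⊢; exact hfT _ ih
  have hsucc : ∀ n, s (n + 1) = f (s n) := fun n => Function.iterate_succ_apply' f n c
  obtain ⟨n, hn⟩ := hS.acc s fun n x hx => by rw [hsucc]; exact hf _ (hs n) x hx
  exact hx1 _ (hs n) (hn (n + 1) (by omega) _ (by rw [hsucc]; exact hx0 _ (hs n)))

/-- There are no nonzero nil right ideals. -/
theorem eq_zero_of_forall_isNilpotent_mul {z : S} (hz : ∀ x, IsNilpotent (z * x)) : z = 0 := by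
  by_contra hz0
  obtain ⟨c, ⟨hc0, y, rfl⟩, hc⟩ := hS.exists_maximal_annihilator
    (T := {c | c ≠ 0 ∧ ∃ y, c = z * y}) ⟨z, hz0, 1, by simp⟩
  have hcc : ∀ x, z * y * x * (z * y) = 0 := by
    intro x
    by_cases hw : z * y * x = 0
    · rw [hw, zero_mul]
    have hnil : ∃ n, (z * y * x) ^ (n + 1) = 0 := by
      obtain ⟨n, hn⟩ := hz (y * x)
      exact ⟨n, by rw [mul_assoc, pow_succ, hn, zero_mul]⟩
    classical
    have hn := Nat.find_spec hnil
    have hmin : (z * y * x) ^ Nat.find hnil ≠ 0 := by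
      rcases h : Nat.find hnil with _ | k
      · rw [h] at hn; simp [hw] at hn
      · exact Nat.find_min hnil (by omega)
    obtain ⟨k, hk⟩ : ∃ k, Nat.find hnil = k + 1 := by
      refine Nat.exists_eq_succ_of_ne_zero fun h => ?_
      rw [h] at hn; simp [hw] at hn
    rw [hk] at hn hmin
    refine hc _ ⟨hmin, y * x * (z * y * x) ^ k, by rw [pow_succ']; simp only [mul_assoc]⟩ ?_ _
      (by rw [← pow_succ', hn])
    intro u hu
    rw [pow_succ', ← mul_assoc, ← mul_assoc, hu, zero_mul, zero_mul]
  rcases hS.prime.eq_zero_or_eq_zero _ _ hcc with h | h <;> exact hc0 h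

/-- The left singular ideal is zero. -/
theorem eq_zero_of_isEssential_annihilator {z : S}
    (hz : ∀ a : S, a ≠ 0 → ∃ x, x * a ≠ 0 ∧ x * a * z = 0) : z = 0 := by
  refine hS.eq_zero_of_forall_isNilpotent_mul fun y => ?_
  obtain ⟨n, hn⟩ := hS.acc (fun n => (z * y) ^ n) fun n x hx => by
    simp only [pow_succ, ← mul_assoc] at hx ⊢; rw [hx, zero_mul, zero_mul]
  by_contra hnil
  obtain ⟨x, hx0, hx⟩ := hz ((z * y) ^ n) fun h => hnil ⟨n, h⟩
  apply hx0
  apply hn (n + 1) (by omega)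
  rw [pow_succ, ← mul_assoc, ← mul_assoc, hx, zero_mul]

/-- A nonzero left ideal contains a nonzero element with the same left annihilator as its square. -/
theorem exists_annihilator_sq {J : Submodule S S} (hJ : J ≠ ⊥) :
    ∃ y ∈ J, y ≠ 0 ∧ ∀ x, x * y * y = 0 → x * y = 0 := by
  obtain ⟨a, ha, ha0⟩ := J.ne_bot_iff.1 hJ
  have : ∃ x, ¬ IsNilpotent (a * x) := by
    by_contra! h
    exact ha0 (hS.eq_zero_of_forall_isNilpotent_mul h)
  obtain ⟨x, hx⟩ := this
  have hnil : ∀ n, (x * a) ^ n ≠ 0 := by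
    intro n hn
    refine hx ⟨n + 1, ?_⟩
    rw [pow_succ, ← mul_assoc, (show (a * x) ^ n * a = a * (x * a) ^ n from ?_), hn, mul_zero,
      zero_mul]
    exact (SemiconjBy.pow_right (show SemiconjBy a (x * a) (a * x) from by
      rw [SemiconjBy, mul_assoc]) n).eq.symm
  obtain ⟨n, hn⟩ := hS.acc (fun n => (x * a) ^ (n + 1)) fun n u hu => by
    rw [pow_succ (x * a) (n + 1), ← mul_assoc, hu, zero_mul]
  refine ⟨(x * a) ^ (n + 1), ?_, hnil _, fun u hu => ?_⟩
  · rw [pow_succ, ← mul_assoc]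
    exact J.smul_mem _ ha
  · refine hn (2 * n + 1) (by omega) u ?_
    rwa [mul_assoc, ← pow_add, show n + 1 + (n + 1) = 2 * n + 1 + 1 by ring] at hu

/-- The main point of Goldie's theorem: an essential left ideal contains an element whose left
annihilator is zero. Elements `y n` with `y j * y i = 0` for `i < j` and with the same left
annihilators as their squares form a direct sum of left ideals, so that the process of adding to
`t = y 0 + ⋯ + y (n - 1)` a further such element annihilated by `t` stops. -/
theorem exists_regular_mem {J : Submodule S S} (hJ : IsEssentialLeftIdeal J) :
    ∃ s ∈ J, ∀ x, x * s = 0 → x = 0 := by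
  by_contra! hcon
  have hstep : ∀ t : {t // t ∈ J ∧ ∀ x, x * t * t = 0 → x * t = 0},
      ∃ y ∈ J, y ≠ 0 ∧ (∀ x, x * y * y = 0 → x * y = 0) ∧ y * t.1 = 0 := by
    rintro ⟨t, ht, ht2⟩
    obtain ⟨a, ha, ha0⟩ := hcon t ht
    obtain ⟨x, hx0, hxJ⟩ := hJ a ha0
    obtain ⟨y, hy, hy0, hy2⟩ := hS.exists_annihilator_sq
      (J := J ⊓ LinearMap.ker (LinearMap.toSpanSingleton S S t))
      ((Submodule.ne_bot_iff _).2 ⟨x * a, ⟨hxJ, by simp [mul_assoc, ha]⟩, hx0⟩)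
    exact ⟨y, hy.1, hy0, hy2, by simpa using hy.2⟩
  choose y hyJ hy0 hy2 hyt using hstep
  have hadd : ∀ t x, x * (t.1 + y t) = 0 → x * t.1 = 0 ∧ x * y t = 0 := by
    intro t x hx
    have h1 : x * t.1 = 0 := by
      apply t.2.2
      have := congrArg (· * t.1) hx
      simpa [mul_add, add_mul, mul_assoc, hyt] using this
    refine ⟨h1, ?_⟩
    rwa [mul_add, h1, zero_add] at hx
  let next (t : {t // t ∈ J ∧ ∀ x, x * t * t = 0 → x * t = 0}) :
      {t // t ∈ J ∧ ∀ x, x * t * t = 0 → x * t = 0} :=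
    ⟨t.1 + y t, J.add_mem t.2.1 (hyJ t), fun x hx => by
      obtain ⟨h1, h2⟩ := hadd t _ hx
      have h3 : x * t.1 = 0 := by
        apply t.2.2
        simpa [mul_add, add_mul, mul_assoc, hyt] using h1
      rw [mul_add, h3, zero_add] at h2 ⊢
      exact hy2 _ _ h2⟩
  let t : ℕ → {t // t ∈ J ∧ ∀ x, x * t * t = 0 → x * t = 0} :=
    fun n => next^[n] ⟨0, J.zero_mem, by simp⟩
  have ht : ∀ n, t (n + 1) = next (t n) := fun n => Function.iterate_succ_apply' _ _ _
  have hann : ∀ n, ∀ x, x * (t n).1 = 0 → ∀ i < n, x * y (t i) = 0 := by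
    intro n
    induction n with
    | zero => intro x _ i hi; omega
    | succ n ih =>
      intro x hx i hi
      rw [ht] at hx
      obtain ⟨h1, h2⟩ := hadd _ _ hx
      rcases Nat.lt_succ_iff_lt_or_eq.1 hi with hi | rfl
      · exact ih x h1 i hi
      · exact h2
  -- If `z * t n = 0` and `z` is in the sum of the `S * y i` with `i < n`, then `z = 0`: multiply
  -- by `y 0`, `y 1`, … in turn from the right.
  obtain ⟨n, x, hx0, hx⟩ := hS.fud (fun n => y (t n)) fun n => hy0 _
  obtain ⟨r, hr⟩ := exists_eq_sum_range_of_mem_span_image_Iio hx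
  have hz : ∀ i < n, x * y (t n) * y (t i) = 0 := fun i hi => by
    rw [mul_assoc, hann n _ (hyt (t n)) i hi, mul_zero]
  have hzero : ∀ i < n, r i * y (t i) = 0 := by
    intro i
    induction i using Nat.strong_induction_on with
    | _ i ih =>
      intro hi
      apply hy2
      have := hz i hi
      rw [← smul_eq_mul x, hr, Finset.sum_mul, Finset.sum_eq_single i] at this
      · exact this
      · intro j hj hji
        rw [smul_eq_mul]
        rcases lt_or_gt_of_ne hji with hlt | hgt
        · rw [ih j hlt (by omega), zero_mul]
        · rw [mul_assoc, hann j _ (hyt (t j)) i hgt, mul_zero]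
      · intro h; exact absurd (Finset.mem_range.2 hi) h
  exact hx0 (by rw [hr]; exact Finset.sum_eq_zero fun i hi => hzero i (Finset.mem_range.1 hi))

/-- If the left annihilator of `s` is zero, then the left ideal generated by `s` is essential. -/
theorem isEssential_span_singleton {s : S} (hs : ∀ x, x * s = 0 → x = 0) :
    IsEssentialLeftIdeal (Submodule.span S {s}) := by
  intro a ha
  by_contra! hcon
  have hp : ∀ n, a * s ^ n ≠ 0 := by
    intro n
    induction n with
    | zero => simpa using ha
    | succ n ih => rw [pow_succ, ← mul_assoc]; exact fun h => ih (hs _ h)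
  have hind : ∀ n, ∀ x, ∀ r : ℕ → S,
      x * (a * s ^ n) = ∑ i ∈ Finset.range n, r i * (a * s ^ i) → x * (a * s ^ n) = 0 := by
    intro n
    induction n with
    | zero => intro x r h; simpa using h
    | succ n ih =>
      intro x r h
      rw [Finset.sum_range_succ'] at h
      have hsum : ∑ i ∈ Finset.range n, r (i + 1) * (a * s ^ (i + 1))
          = (∑ i ∈ Finset.range n, r (i + 1) * (a * s ^ i)) * s := by
        rw [Finset.sum_mul]
        exact Finset.sum_congr rfl fun i _ => by rw [pow_succ]; simp only [mul_assoc]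
      have hx : x * (a * s ^ (n + 1)) = x * (a * s ^ n) * s := by
        rw [pow_succ]; simp only [mul_assoc]
      rw [hsum, hx, pow_zero, mul_one] at h
      have h0 : r 0 * a = 0 := by
        by_contra h0
        refine hcon _ h0 (Submodule.mem_span_singleton.2
          ⟨x * (a * s ^ n) - ∑ i ∈ Finset.range n, r (i + 1) * (a * s ^ i), ?_⟩)
        rw [smul_eq_mul, sub_mul, h]; abel
      rw [h0, add_zero, ← sub_eq_zero, ← sub_mul] at h
      rw [hx, ih x (fun i => r (i + 1)) (sub_eq_zero.1 (hs _ h)), zero_mul]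
  obtain ⟨n, x, hx0, hx⟩ := hS.fud _ hp
  obtain ⟨r, hr⟩ := exists_eq_sum_range_of_mem_span_image_Iio hx
  exact hx0 (hind n x r hr)

end IsPrimeLeftGoldie

/-! ### Dense submodules -/

section Dense

variable {S M : Type*} [Ring S] [AddCommGroup M] [Module S M]

/-- A submodule `D` is dense if for each `z` the elements carrying `z` into `D` form an essential
left ideal. -/
def IsDenseSubmodule (D : Submodule S M) : Prop :=
  ∀ (z : M) (a : S), a ≠ 0 → ∃ x : S, x * a ≠ 0 ∧ (x * a) • z ∈ D

theorem IsEssentialLeftIdeal.isDenseSubmodule {J : Submodule S S} (hJ : IsEssentialLeftIdeal J) :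
    IsDenseSubmodule J := by
  intro z a ha
  by_cases h : a * z = 0
  · exact ⟨1, by simpa using ha, by simp [h]⟩
  · obtain ⟨x, hx0, hx⟩ := hJ _ h
    exact ⟨x, fun h => hx0 (by rw [← mul_assoc, h, zero_mul]), by simpa [mul_assoc] using hx⟩

theorem IsDenseSubmodule.forall_mem_finset {D : Submodule S M} (hD : IsDenseSubmodule D)
    (Z : Finset M) (a : S) (ha : a ≠ 0) : ∃ x : S, x * a ≠ 0 ∧ ∀ z ∈ Z, (x * a) • z ∈ D := by
  classical
  induction Z using Finset.induction_on with
  | empty => exact ⟨1, by simpa using ha, by simp⟩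
  | insert z Z _ ih =>
    obtain ⟨x, hx0, hx⟩ := ih
    obtain ⟨y, hy0, hy⟩ := hD z _ hx0
    refine ⟨y * x, by rwa [mul_assoc], fun u hu => ?_⟩
    rcases Finset.mem_insert.1 hu with rfl | hu
    · rwa [mul_assoc]
    · rw [mul_assoc, mul_smul]
      exact D.smul_mem _ (hx u hu)

/-- Finitely many elements are carried into a dense submodule by a single element with zero left
annihilator. -/
theorem IsDenseSubmodule.exists_regular (hS : IsPrimeLeftGoldie S) {D : Submodule S M}
    (hD : IsDenseSubmodule D) (Z : Finset M) :
    ∃ s : S, (∀ x, x * s = 0 → x = 0) ∧ ∀ z ∈ Z, s • z ∈ D := by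
  let J : Submodule S S := ⨅ z ∈ Z, D.comap (LinearMap.toSpanSingleton S M z)
  have hmem : ∀ x, x ∈ J ↔ ∀ z ∈ Z, x • z ∈ D := by simp [J, Submodule.mem_iInf]
  obtain ⟨s, hsJ, hs⟩ := hS.exists_regular_mem (J := J) fun a ha => by
    obtain ⟨x, hx0, hx⟩ := hD.forall_mem_finset Z a ha
    exact ⟨x, hx0, (hmem _).2 hx⟩
  exact ⟨s, hs, (hmem s).1 hsJ⟩

theorem IsDenseSubmodule.exists_mul_ne_zero (hS : IsPrimeLeftGoldie S) {D : Submodule S M}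
    (hD : IsDenseSubmodule D) (Z : Finset M) {u : S} (hu : u ≠ 0) :
    ∃ b : S, b * u ≠ 0 ∧ ∀ z ∈ Z, b • z ∈ D := by
  by_contra! hcon
  refine hu (hS.eq_zero_of_isEssential_annihilator fun a ha => ?_)
  obtain ⟨x, hx0, hx⟩ := hD.forall_mem_finset Z a ha
  refine ⟨x, hx0, by_contra fun h => ?_⟩
  obtain ⟨z, hz, hzD⟩ := hcon _ h
  exact hzD (hx z hz)

/-- Let `M` embed in a free module of finite rank. Then `M` has an essential submodule that is a
direct sum of cyclic modules `S m j`, all with the same annihilator as an element `c ≠ 0` with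
maximal left annihilator. By maximality the left ideal `S c` maps injectively under each nonzero
right multiplication, so that a copy of it is found in every nonzero submodule of `M`. -/
theorem IsPrimeLeftGoldie.exists_family (hS : IsPrimeLeftGoldie S) {c : S} (hc0 : c ≠ 0)
    (hc : ∀ d, d ≠ 0 → (∀ x, x * c = 0 → x * d = 0) → ∀ x, x * d = 0 → x * c = 0)
    {m : ℕ} (Φ : M →ₗ[S] (Fin m → S)) (hΦ : Function.Injective Φ) :
    ∃ (n : ℕ) (p : Fin n → M), (∀ i x, x * c = 0 → x • p i = 0) ∧
      (∀ r : Fin n → S, ∑ i, r i • p i = 0 → ∀ i, r i * c = 0) ∧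
      IsDenseSubmodule (Submodule.span S (Set.range p)) := by
  -- The family is maximal among the elements with the same annihilator as `c`.
  obtain ⟨n, p, hP, hind, hmax⟩ := ((hS.fud.pi_fin m).of_injective Φ hΦ).exists_maximal_family
    fun q => ∀ x : S, x • q = 0 ↔ x * c = 0
  refine ⟨n, p, fun i x hx => (hP i x).2 hx, fun r hr i => (hP i _).1 (hind r hr i), ?_⟩
  intro z a ha
  by_cases haz : a • z = 0
  · exact ⟨1, by simpa using ha, by simp [haz]⟩
  obtain ⟨i, hi⟩ : ∃ i, Φ (a • z) i ≠ 0 := by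
    by_contra! h
    exact haz ((map_eq_zero_iff Φ hΦ).1 (funext h))
  obtain ⟨b, hb⟩ : ∃ b, c * b * Φ (a • z) i ≠ 0 := by
    by_contra! h
    rcases hS.prime.eq_zero_or_eq_zero _ _ h with h | h
    · exact hc0 h
    · exact hi h
  have hann : ∀ x : S, x • (c * b) • a • z = 0 ↔ x * c = 0 := by
    intro x
    constructor
    · intro hx
      refine hc _ hb (fun x hx => by rw [← mul_assoc, ← mul_assoc, hx, zero_mul, zero_mul]) x ?_
      have := congrFun (congrArg Φ hx) i
      simpa [mul_assoc] using this
    · intro hx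
      rw [← mul_smul, ← mul_assoc, hx, zero_mul, zero_smul]
  have hne : (c * b) • a • z ≠ 0 := fun h => hb (by
    have := congrFun (congrArg Φ h) i
    simpa [mul_assoc] using this)
  obtain ⟨x, hx0, hx⟩ := hmax _ hann hne
  refine ⟨x * (c * b), fun h => hx0 ?_, ?_⟩
  · rw [← mul_smul, ← mul_smul, h, zero_smul]
  · simpa only [mul_smul] using hx

/-- Let `M` embed in a free module of finite rank. Then some power of `M` contains a dense free
submodule of finite positive rank. The passage to a power is needed because the rank of `M` over the
simple Artinian quotient ring of `S` may be fractional. -/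
theorem IsPrimeLeftGoldie.exists_free_dense (hS : IsPrimeLeftGoldie S) [Nontrivial M]
    {m : ℕ} (Φ : M →ₗ[S] (Fin m → S)) (hΦ : Function.Injective Φ) :
    ∃ (r l : ℕ) (e : Fin l → Fin r → M), 0 < l ∧
      (∀ b : Fin l → S, ∑ j, b j • e j = 0 → b = 0) ∧
      IsDenseSubmodule (Submodule.span S (Set.range e)) := by
  have := hS.prime.nontrivial
  obtain ⟨c, hc0, hc⟩ := hS.exists_maximal_annihilator (T := {c | c ≠ 0}) ⟨1, one_ne_zero⟩
  obtain ⟨r, y, hy, hyind, hydense⟩ := hS.exists_family (M := S) hc0 hc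
    (m := 1) (LinearMap.pi fun _ => LinearMap.id) fun a b h => congrFun h 0
  obtain ⟨l, p, hp, hpind, hpdense⟩ := hS.exists_family hc0 hc Φ hΦ
  obtain ⟨s, hs, hs1⟩ := hydense.exists_regular hS {1}
  have hsy := hs1 1 (Finset.mem_singleton_self 1)
  rw [smul_eq_mul, mul_one, Submodule.mem_span_range_iff_exists_fun] at hsy
  obtain ⟨a, ha⟩ := hsy
  have hsdense := (hS.isEssential_span_singleton hs).isDenseSubmodule
  refine ⟨r, l, fun j i => a i • p j, ?_, ?_, ?_⟩
  · rcases Nat.eq_zero_or_pos l with rfl | h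
    · exfalso
      obtain ⟨z, hz⟩ := exists_ne (0 : M)
      refine hz (hΦ (funext fun i => ?_))
      rw [map_zero, Pi.zero_apply]
      refine hS.eq_zero_of_isEssential_annihilator fun a ha => ?_
      obtain ⟨x, hx0, hx⟩ := hpdense z a ha
      rw [Set.range_eq_empty, Submodule.span_empty, Submodule.mem_bot] at hx
      refine ⟨x, hx0, ?_⟩
      rw [← smul_eq_mul (x * a), ← Pi.smul_apply, ← map_smul, hx, map_zero, Pi.zero_apply]
    · exact h
  · intro b hb
    funext j
    apply hs
    rw [← ha, Finset.mul_sum]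
    refine Finset.sum_eq_zero fun i _ => ?_
    have h := congrFun hb i
    simp only [Finset.sum_apply, Pi.smul_apply, Pi.zero_apply, ← mul_smul] at h
    rw [smul_eq_mul, ← mul_assoc]
    exact hy i _ (hpind _ h j)
  · intro z x hx
    classical
    -- First carry all coordinates of `z` into the span of `p`, with coefficients `v i j`.
    obtain ⟨x₁, hx₁0, hx₁⟩ := hpdense.forall_mem_finset (Finset.univ.image z) x hx
    have hv : ∀ i, ∃ v : Fin l → S, ∑ j, v j • p j = (x₁ * x) • z i := fun i =>
      (Submodule.mem_span_range_iff_exists_fun S).1 (hx₁ (z i) (by simp))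
    choose v hv using hv
    -- Then carry the elements `∑ i, v i j * y i` into the left ideal `S s`.
    obtain ⟨b, hb0, hb⟩ := hsdense.exists_mul_ne_zero hS
      (Finset.univ.image fun j => ∑ i, v i j * y i) hx₁0
    have ht : ∀ j, ∃ t, t * s = b * ∑ i, v i j * y i := fun j =>
      Submodule.mem_span_singleton.1 (hb _ (by simp))
    choose t ht using ht
    have hcoef : ∀ i j, (b * v i j - t j * a i) * c = 0 := by
      intro i j
      refine hyind (fun i => b * v i j - t j * a i) ?_ i
      have h := ht j
      rw [← ha, Finset.mul_sum, Finset.mul_sum] at h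
      simp only [smul_eq_mul, sub_mul, Finset.sum_sub_distrib]
      rw [sub_eq_zero]
      simpa [mul_assoc] using h.symm
    refine ⟨b * x₁, by rwa [mul_assoc], (Submodule.mem_span_range_iff_exists_fun S).2 ⟨t, ?_⟩⟩
    funext i
    rw [mul_assoc, mul_smul, Pi.smul_apply, Pi.smul_apply, ← hv i, Finset.smul_sum,
      Finset.sum_apply]
    refine Finset.sum_congr rfl fun j _ => ?_
    have h := hp j _ (hcoef i j)
    rw [sub_smul, sub_eq_zero, mul_smul, mul_smul] at h
    exact h.symm

/-- Let rows `v x` and columns `u` be paired by `∑ i, v x i * u i`. The rows span a module of finite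
uniform dimension, so that finitely many of them span a dense submodule; a column annihilated by
these has an essential annihilator of each of its products with the other rows. -/
theorem IsPrimeLeftGoldie.exists_finset_annihilating (hS : IsPrimeLeftGoldie S)
    {ι X : Type*} [Fintype ι] (v : X → ι → S) :
    ∃ (n : ℕ) (x : Fin n → X), ∀ u : ι → S,
      (∀ j, ∑ i, v (x j) i * u i = 0) → ∀ x, ∑ i, v x i * u i = 0 := by
  obtain ⟨n, p, hP, -, hmax⟩ := (hS.fud.pi (ι := ι)).exists_maximal_family
    fun q => ∃ x : X, ∃ a : S, q = a • v x
  choose x a hx using hP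
  refine ⟨n, x, fun u hu z => hS.eq_zero_of_isEssential_annihilator fun b hb => ?_⟩
  let ρ : (ι → S) →ₗ[S] S := ∑ i, (LinearMap.toSpanSingleton S S (u i)).comp (LinearMap.proj i)
  have hρ : ∀ w, ρ w = ∑ i, w i * u i := fun w => by simp [ρ]
  by_cases hbz : b • v z = 0
  · refine ⟨1, by simpa using hb, ?_⟩
    rw [one_mul, ← hρ, ← smul_eq_mul, ← map_smul, hbz, map_zero]
  obtain ⟨y, hy0, hy⟩ := hmax _ ⟨z, b, rfl⟩ hbz
  refine ⟨y, fun h => hy0 (by rw [← mul_smul, h, zero_smul]), ?_⟩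
  have hker : Submodule.span S (Set.range p) ≤ LinearMap.ker ρ := by
    rw [Submodule.span_le]
    rintro _ ⟨j, rfl⟩
    rw [SetLike.mem_coe, LinearMap.mem_ker, hx, map_smul, hρ, hu, smul_zero]
  have := hker hy
  rw [LinearMap.mem_ker, ← mul_smul, map_smul, hρ] at this
  exact this

end Dense

/-! ### Finite groups acting on division rings -/

section DivisionRing

variable {Γ D : Type*} [Group Γ] [DivisionRing D] (σ : Γ →* (D →+* D))

theorem MonoidHom.ringEnd_mul_apply {R : Type*} [Ring R] (σ : Γ →* (R →+* R)) (g h : Γ) (a : R) :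
    σ (g * h) a = σ g (σ h a) := by rw [map_mul]; rfl

theorem MonoidHom.ringEnd_one_apply {R : Type*} [Ring R] (σ : Γ →* (R →+* R)) (a : R) :
    σ 1 a = a := by rw [map_one]; rfl

theorem MonoidHom.ringEnd_injective {R : Type*} [Ring R] (σ : Γ →* (R →+* R)) (g : Γ) :
    Function.Injective (σ g) := by
  refine Function.LeftInverse.injective (g := σ g⁻¹) fun a => ?_
  rw [← σ.ringEnd_mul_apply, inv_mul_cancel, σ.ringEnd_one_apply]

/-- The division subring of elements fixed by a group of endomorphisms of a division ring. -/
def fixedSubfield : Subfield D where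
  carrier := {a | ∀ g, σ g a = a}
  mul_mem' ha hb g := by rw [map_mul, ha g, hb g]
  one_mem' g := map_one _
  add_mem' ha hb g := by rw [map_add, ha g, hb g]
  zero_mem' g := map_zero _
  neg_mem' ha g := by rw [map_neg, ha g]
  inv_mem' a ha g := by rw [map_inv₀, ha g]

/-- Artin's lemma for division rings. -/
theorem linearIndependent_orbit {ι : Type*} {v : ι → D}
    (hv : LinearIndependent (fixedSubfield σ) v) :
    LinearIndependent D fun i => (fun g => σ g (v i) : Γ → D) := by
  classical
  rw [linearIndependent_iff']
  intro s
  induction s using Finset.induction_on with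
  | empty => intro c _ i hi; simp at hi
  | insert a s ha ih =>
    intro c hc
    have hca : c a = 0 := by
      by_contra hca
      -- Normalize the relation to have coefficient `1` at `a`; its difference with its transform
      -- under `h` is a shorter relation.
      have hsum : ∀ g, ∑ i ∈ s, (c a)⁻¹ * c i * σ g (v i) + σ g (v a) = 0 := by
        intro g
        have := congrFun hc g
        rw [Finset.sum_insert ha] at this
        simp only [Pi.add_apply, Finset.sum_apply, Pi.smul_apply, smul_eq_mul, Pi.zero_apply]
          at this
        have h2 := congrArg ((c a)⁻¹ * ·) this
        simp only [mul_add, Finset.mul_sum, mul_zero, inv_mul_cancel_left₀ hca] at h2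
        rw [add_comm]
        simpa only [mul_assoc] using h2
      have hfix : ∀ i ∈ s, ∀ h, σ h ((c a)⁻¹ * c i) = (c a)⁻¹ * c i := by
        intro i hi h
        refine sub_eq_zero.1 (ih (fun i => σ h ((c a)⁻¹ * c i) - (c a)⁻¹ * c i) ?_ i hi)
        funext g
        have h1 := congrArg (σ h) (hsum (h⁻¹ * g))
        rw [map_add, map_sum, map_zero] at h1
        simp only [map_mul (σ h) (_ * _), ← σ.ringEnd_mul_apply, mul_inv_cancel_left] at h1
        simp only [Finset.sum_apply, Pi.smul_apply, smul_eq_mul, Pi.zero_apply, sub_mul,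
          Finset.sum_sub_distrib]
        rw [eq_neg_of_add_eq_zero_left h1, eq_neg_of_add_eq_zero_left (hsum g), sub_self]
      rw [linearIndependent_iff'] at hv
      have h1 := hv (insert a s) (fun i => if h : i ∈ s then ⟨_, hfix i h⟩ else 1) (by
        rw [Finset.sum_insert ha, dif_neg ha, one_smul, add_comm]
        rw [← hsum 1]
        simp only [σ.ringEnd_one_apply]
        congr 1
        refine Finset.sum_congr rfl fun i hi => ?_
        rw [dif_pos hi]; rfl) a (Finset.mem_insert_self a s)
      rw [dif_neg ha] at h1
      exact one_ne_zero h1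
    rw [Finset.sum_insert ha, hca, zero_smul, zero_add] at hc
    intro i hi
    rcases Finset.mem_insert.1 hi with rfl | hi
    · exact hca
    · exact ih c hc i hi

variable [Finite Γ]

theorem finite_fixedSubfield : Module.Finite (fixedSubfield σ) D := by
  let b := Module.Basis.ofVectorSpace (fixedSubfield σ) D
  have := (linearIndependent_orbit σ b.linearIndependent).finite
  exact Module.Finite.of_basis b

/-- The coordinate functionals of a division ring over its fixed division ring are combinations of
the group elements, with coefficients on the right. -/
theorem exists_coordinates [Fintype Γ] :
    ∃ (n : ℕ) (f : Fin n → (D →ₗ[fixedSubfield σ] fixedSubfield σ)) (d : Fin n → Γ → D),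
      (∀ i z, (f i z : D) = ∑ g, σ g z * d i g) ∧
      ∀ z, (∀ i, f i z = 0) → z = 0 := by
  classical
  have := finite_fixedSubfield σ
  let b := Module.finBasis (fixedSubfield σ) D
  have hli := linearIndependent_orbit σ b.linearIndependent
  have hL : ∀ i, ∃ L : (Γ → D) →ₗ[D] D, ∀ j, L (fun g => σ g (b j)) = if j = i then 1 else 0 := by
    intro i
    obtain ⟨L, hL⟩ := LinearMap.exists_extend
      ((Module.Basis.span hli).constr ℕ fun j => if j = i then (1 : D) else 0)
    refine ⟨L, fun j => ?_⟩
    have h1 : L ((Module.Basis.span hli j : _) : Γ → D) = _ := LinearMap.congr_fun hL _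
    rw [Module.Basis.constr_basis, Module.Basis.span_apply] at h1
    exact h1
  choose L hL using hL
  refine ⟨_, fun i => b.coord i, fun i g => L i (Pi.single g 1), fun i z => ?_, fun z hz => ?_⟩
  · have h1 : ∑ g, σ g z * L i (Pi.single g 1) = L i (fun g => σ g z) := by
      conv_rhs => rw [pi_eq_sum_univ' (fun g => σ g z)]
      simp only [map_sum, map_smul, smul_eq_mul]
    have h2 : (fun g => σ g z) = ∑ j, (b.coord j z : D) • fun g => σ g (b j) := by
      funext g
      conv_lhs => rw [← b.sum_repr z]
      rw [map_sum, Finset.sum_apply]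
      refine Finset.sum_congr rfl fun j _ => ?_
      rw [Subfield.smul_def, smul_eq_mul, map_mul, (b.repr z j).2 g]
      rfl
    rw [h1, h2, map_sum, Finset.sum_eq_single i]
    · rw [map_smul, hL, if_pos rfl, smul_eq_mul, mul_one]
    · intro j _ hj; rw [map_smul, hL, if_neg hj, smul_zero]
    · simp
  · exact b.forall_coord_eq_zero_iff.1 hz

end DivisionRing

/-! ### Forms with values in the invariants -/

/-- Finitely many jointly injective maps `y ↦ ∑ g, σ g y * c g` with values in the ring of
invariants. They are linear for left multiplication by invariants, so that they embed the ring in a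
free left module of finite rank over its invariants. -/
def HasInvariantForms {Γ R : Type*} [Group Γ] [Fintype Γ] [Ring R] (σ : Γ →* (R →+* R)) : Prop :=
  ∃ (n : ℕ) (c : Fin n → Γ → R),
    (∀ i y h, σ h (∑ g, σ g y * c i g) = ∑ g, σ g y * c i g) ∧
    ∀ y, (∀ i, ∑ g, σ g y * c i g = 0) → y = 0

section Localization

variable {Γ D A : Type*} [Group Γ] [Fintype Γ] [DivisionRing D] [Ring A]

theorem exists_common_right_denominator [Nontrivial A] [NoZeroDivisors A] (j : A →+* D)
    (hr : ∀ d, ∃ s a, s ≠ 0 ∧ d * j s = j a) {ι : Type*} [Fintype ι] (d : ι → D) :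
    ∃ s, s ≠ 0 ∧ ∀ i, ∃ a, d i * j s = j a := by
  classical
  suffices h : ∀ t : Finset ι, ∃ s, s ≠ 0 ∧ ∀ i ∈ t, ∃ a, d i * j s = j a by
    obtain ⟨s, hs, h⟩ := h Finset.univ
    exact ⟨s, hs, fun i => h i (Finset.mem_univ i)⟩
  intro t
  induction t using Finset.induction_on with
  | empty => exact ⟨1, one_ne_zero, by simp⟩
  | insert i t _ ih =>
    obtain ⟨s, hs, h⟩ := ih
    obtain ⟨s', a, hs', ha⟩ := hr (d i * j s)
    refine ⟨s * s', mul_ne_zero hs hs', fun k hk => ?_⟩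
    rcases Finset.mem_insert.1 hk with rfl | hk
    · exact ⟨a, by rw [map_mul, ← mul_assoc, ha]⟩
    · obtain ⟨b, hb⟩ := h k hk
      exact ⟨b * s', by rw [map_mul, ← mul_assoc, hb, map_mul]⟩

theorem exists_common_left_denominator [Nontrivial A] [NoZeroDivisors A] (j : A →+* D)
    (hl : ∀ d, ∃ s a, s ≠ 0 ∧ j s * d = j a) {ι : Type*} [Fintype ι] (d : ι → D) :
    ∃ s, s ≠ 0 ∧ ∀ i, ∃ a, j s * d i = j a := by
  classical
  suffices h : ∀ t : Finset ι, ∃ s, s ≠ 0 ∧ ∀ i ∈ t, ∃ a, j s * d i = j a by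
    obtain ⟨s, hs, h⟩ := h Finset.univ
    exact ⟨s, hs, fun i => h i (Finset.mem_univ i)⟩
  intro t
  induction t using Finset.induction_on with
  | empty => exact ⟨1, one_ne_zero, by simp⟩
  | insert i t _ ih =>
    obtain ⟨s, hs, h⟩ := ih
    obtain ⟨s', a, hs', ha⟩ := hl (j s * d i)
    refine ⟨s' * s, mul_ne_zero hs' hs, fun k hk => ?_⟩
    rcases Finset.mem_insert.1 hk with rfl | hk
    · exact ⟨a, by rw [map_mul, mul_assoc, ha]⟩
    · obtain ⟨b, hb⟩ := h k hk
      exact ⟨s' * b, by rw [map_mul, mul_assoc, hb, map_mul]⟩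

variable {σ : Γ →* (D →+* D)} {τ : Γ →* (A →+* A)} {j : A →+* D}

/-- A nonzero right ideal of an Ore domain spans its division ring of fractions over the invariants:
the span has finite dimension, so that right multiplication by a nonzero element of the domain maps
it onto itself. -/
theorem span_fixedSubfield_eq_top (hj : Function.Injective j)
    (hr : ∀ d, ∃ s a, s ≠ 0 ∧ d * j s = j a) {y : A} (hy : y ≠ 0) :
    Submodule.span (fixedSubfield σ) (Set.range fun a => j (y * a)) = ⊤ := by
  have := finite_fixedSubfield σ
  set P := Submodule.span (fixedSubfield σ) (Set.range fun a => j (y * a)) with hP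
  let m (x : A) : D →ₗ[fixedSubfield σ] D :=
    { toFun := fun z => z * j x
      map_add' := fun z w => add_mul z w _
      map_smul' := fun c z => by simp [Subfield.smul_def, mul_assoc] }
  have hm : ∀ x, ∀ z ∈ P, m x z ∈ P := by
    intro x z hz
    have : P ≤ P.comap (m x) := by
      conv_lhs => rw [hP]
      rw [Submodule.span_le]
      rintro _ ⟨a, rfl⟩
      exact Submodule.subset_span ⟨a * x, by simp [m, mul_assoc]⟩
    exact this hz
  have hinv : ∀ x, x ≠ 0 → ∀ z ∈ P, z * (j x)⁻¹ ∈ P := by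
    intro x hx z hz
    have hjx : j x ≠ 0 := (map_ne_zero_iff j hj).2 hx
    have hinj : Function.Injective ((m x).restrict (hm x)) := fun u v h => by
      have := congrArg Subtype.val h
      exact Subtype.ext (mul_right_cancel₀ hjx this)
    obtain ⟨w, hw⟩ := LinearMap.surjective_of_injective hinj ⟨z, hz⟩
    have hwz : w.1 * j x = z := congrArg Subtype.val hw
    rw [← hwz, mul_inv_cancel_right₀ hjx]
    exact w.2
  rw [Submodule.eq_top_iff']
  intro z
  have hjy : j y ≠ 0 := (map_ne_zero_iff j hj).2 hy
  obtain ⟨s, a, hs, ha⟩ := hr ((j y)⁻¹ * z)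
  have hz : z = j (y * a) * (j s)⁻¹ := by
    rw [map_mul, ← ha, ← mul_assoc, mul_inv_cancel_left₀ hjy, mul_inv_cancel_right₀]
    exact (map_ne_zero_iff j hj).2 hs
  rw [hz]
  exact hinv s hs _ (Submodule.subset_span ⟨a, rfl⟩)

/-- In an Ore domain with an action of a finite group, every nonzero principal right ideal contains
a nonzero invariant. The invariant is a value at an element of an invariant right ideal of a
functional `∑ g, σ g z * d g` on the division ring of fractions. -/
theorem exists_invariant_mem_mul [Nontrivial A] [NoZeroDivisors A] (hj : Function.Injective j)
    (hl : ∀ d, ∃ s a, s ≠ 0 ∧ j s * d = j a) (hr : ∀ d, ∃ s a, s ≠ 0 ∧ d * j s = j a)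
    (hσ : ∀ g a, σ g (j a) = j (τ g a)) {s : A} (hs : s ≠ 0) :
    ∃ b, b ≠ 0 ∧ (∀ g, τ g b = b) ∧ ∃ a, b = s * a := by
  have hjne : ∀ {x}, x ≠ 0 → j x ≠ 0 := fun h => (map_ne_zero_iff j hj).2 h
  obtain ⟨n, f, d, hfd, hf0⟩ := exists_coordinates σ
  obtain ⟨i, hi⟩ : ∃ i, f i 1 ≠ 0 := by
    by_contra! h
    exact one_ne_zero (hf0 1 h)
  -- `y` lies in the invariant right ideal `J = ⋂ g, (τ g s) A`.
  obtain ⟨y, hy, hyJ⟩ := exists_common_right_denominator j hr fun g => (j (τ g s))⁻¹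
  have hτs : ∀ g, τ g s ≠ 0 := fun g => (map_ne_zero_iff _ (τ.ringEnd_injective g)).2 hs
  have hyJ' : ∀ g, ∃ a, y = τ g s * a := by
    intro g
    obtain ⟨a, ha⟩ := hyJ g
    refine ⟨a, hj ?_⟩
    rw [map_mul, ← ha, mul_inv_cancel_left₀ (hjne (hτs g))]
  -- `t` clears the denominators: all `σ g t * d i g` lie in `A`, so that the functional carries
  -- `J t` into `J`.
  obtain ⟨t, ht, hta⟩ := exists_common_left_denominator j hl fun g => σ g⁻¹ (d i g)
  choose a ha using hta
  have hta' : ∀ g, j (τ g t) * d i g = j (τ g (a g)) := by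
    intro g
    have := congrArg (σ g) (ha g)
    rwa [map_mul, hσ, hσ, ← σ.ringEnd_mul_apply, mul_inv_cancel, σ.ringEnd_one_apply] at this
  have hval : ∀ x, (f i (j x * j t) : D) = j (∑ g, τ g x * τ g (a g)) := by
    intro x
    rw [hfd, map_sum]
    refine Finset.sum_congr rfl fun g _ => ?_
    rw [map_mul, hσ, hσ, mul_assoc, hta', map_mul]
  obtain ⟨x, hx⟩ : ∃ x, f i (j (y * x) * j t) ≠ 0 := by
    by_contra! h
    apply hi
    have hall : ∀ z, f i (z * j t) = 0 := by
      intro z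
      have hz : z ∈ Submodule.span (fixedSubfield σ) (Set.range fun a => j (y * a)) := by
        rw [span_fixedSubfield_eq_top hj hr hy]; trivial
      induction hz using Submodule.span_induction with
      | mem z hz => obtain ⟨x, rfl⟩ := hz; exact h x
      | zero => rw [zero_mul, map_zero]
      | add u v _ _ hu hv => rw [add_mul, map_add, hu, hv, add_zero]
      | smul c u _ hu =>
        rw [Subfield.smul_def, smul_eq_mul, mul_assoc, ← smul_eq_mul, ← Subfield.smul_def,
          map_smul, hu, smul_zero]
    have := hall (j t)⁻¹
    rwa [inv_mul_cancel₀ (hjne ht)] at this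
  refine ⟨∑ g, τ g (y * x) * τ g (a g), ?_, ?_, ?_⟩
  · intro h0
    apply hx
    rw [← ZeroMemClass.coe_eq_zero, hval, h0, map_zero]
  · intro g
    apply hj
    rw [← hσ, ← hval]
    exact (f i _).2 g
  · have hmem : ∀ g, ∃ b, τ g (y * x) * τ g (a g) = s * b := by
      intro g
      obtain ⟨b, hb⟩ := hyJ' g⁻¹
      refine ⟨τ g b * τ g x * τ g (a g), ?_⟩
      rw [hb, map_mul, map_mul, ← τ.ringEnd_mul_apply, mul_inv_cancel, τ.ringEnd_one_apply]
      simp only [mul_assoc]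
    choose b hb using hmem
    exact ⟨∑ g, b g, by rw [Finset.mul_sum]; exact Finset.sum_congr rfl fun g _ => hb g⟩

/-- The coordinate functionals of the division ring of fractions over its invariants, multiplied on
the right by an invariant that clears denominators. -/
theorem hasInvariantForms_of_division [Nontrivial A] [NoZeroDivisors A]
    (hj : Function.Injective j)
    (hl : ∀ d, ∃ s a, s ≠ 0 ∧ j s * d = j a) (hr : ∀ d, ∃ s a, s ≠ 0 ∧ d * j s = j a)
    (hσ : ∀ g a, σ g (j a) = j (τ g a)) : HasInvariantForms τ := by
  obtain ⟨n, f, d, hfd, hf0⟩ := exists_coordinates σ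
  obtain ⟨s, hs, hsd⟩ := exists_common_right_denominator j hr
    fun p : Fin n × Γ => d p.1 p.2
  choose a ha using hsd
  obtain ⟨b, hb, hbτ, u, hu⟩ := exists_invariant_mem_mul hj hl hr hσ hs
  have hval : ∀ i y, j (∑ g, τ g y * (a (i, g) * u)) = f i (j y) * j b := by
    intro i y
    rw [hfd, map_sum, Finset.sum_mul]
    refine Finset.sum_congr rfl fun g _ => ?_
    rw [hσ, map_mul, map_mul, ← ha, hu, map_mul]
    simp only [mul_assoc]
  refine ⟨n, fun i g => a (i, g) * u, fun i y h => hj ?_, fun y hy => ?_⟩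
  · rw [← hσ, hval, map_mul, (f i (j y)).2 h, hσ, hbτ]
  · refine (map_eq_zero_iff j hj).1 (hf0 _ fun i => ?_)
    have := hval i y
    rw [hy i, map_zero] at this
    rcases mul_eq_zero.1 this.symm with h | h
    · exact ZeroMemClass.coe_eq_zero.1 h
    · exact absurd h ((map_ne_zero_iff j hj).2 hb)

open OreLocalization nonZeroDivisors in
/-- The action extends to the division ring of left fractions, every element of which is a right
fraction as well by the right Ore condition. -/
theorem hasInvariantForms_of_ore [Nontrivial A] [NoZeroDivisors A] (τ : Γ →* (A →+* A))
    (hl : ∀ r s : A, s ≠ 0 → ∃ r' s', s' ≠ 0 ∧ s' * r = r' * s)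
    (hr : ∀ r s : A, s ≠ 0 → ∃ r' s', s' ≠ 0 ∧ r * s' = s * r') : HasInvariantForms τ := by
  obtain ⟨inst⟩ : Nonempty (OreSet A⁰) := nonempty_oreSet_iff_of_noZeroDivisors.2 fun r s => by
    obtain ⟨r', s', hs', h⟩ := hl r s (nonZeroDivisors.coe_ne_zero s)
    exact ⟨r', ⟨s', mem_nonZeroDivisors_of_ne_zero hs'⟩, h⟩
  let j : A →+* A[A⁰⁻¹] := numeratorRingHom
  have hj : Function.Injective j := numeratorHom_inj fun x hx => hx.1
  have hjne : ∀ {x}, x ≠ 0 → j x ≠ 0 := fun h => (map_ne_zero_iff j hj).2 h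
  have hfrac : ∀ d : A[A⁰⁻¹], ∃ s a, s ≠ 0 ∧ j s * d = j a := by
    intro d
    induction d with | _ r s
    exact ⟨s, r, nonZeroDivisors.coe_ne_zero s, OreLocalization.mul_cancel (s := s) (t := 1)⟩
  let σ' (g : Γ) : A[A⁰⁻¹] →+* A[A⁰⁻¹] := universalHom (j.comp (τ g))
    { toFun := fun s => Units.mk0 (j (τ g s)) (hjne
        ((map_ne_zero_iff _ (τ.ringEnd_injective g)).2 (nonZeroDivisors.coe_ne_zero s)))
      map_one' := by ext; simp
      map_mul' := fun s t => by ext; simp } (fun s => rfl)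
  have hσ' : ∀ g a, σ' g (j a) = j (τ g a) := fun g a => universalHom_commutes _ _ _
  have hext : ∀ f g : A[A⁰⁻¹] →+* A[A⁰⁻¹], (∀ a, f (j a) = g (j a)) → f = g := by
    intro f g h
    ext d
    obtain ⟨s, a, hs, hd⟩ := hfrac d
    have h1 := congrArg f hd
    have h2 := congrArg g hd
    rw [map_mul] at h1 h2
    rw [h, h, ← h2] at h1
    exact mul_left_cancel₀ ((map_ne_zero g).2 (hjne hs)) h1
  let σ : Γ →* (A[A⁰⁻¹] →+* A[A⁰⁻¹]) :=
    { toFun := σ'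
      map_one' := hext _ _ fun a => by rw [hσ', τ.ringEnd_one_apply]; rfl
      map_mul' := fun g h => hext _ _ fun a => by
        rw [hσ', τ.ringEnd_mul_apply, ← hσ', ← hσ']; rfl }
  refine hasInvariantForms_of_division (σ := σ) hj hfrac ?_ hσ'
  intro d
  obtain ⟨s, a, hs, hd⟩ := hfrac d
  obtain ⟨a', s', hs', h⟩ := hr a s hs
  refine ⟨s', a', hs', mul_left_cancel₀ (hjne hs) ?_⟩
  rw [← mul_assoc, hd, ← map_mul, h, map_mul]

end Localization

/-! ### Invariant forms for prime Goldie rings -/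

section InvariantForms

variable {Γ R : Type*} [Group Γ] [Fintype Γ] [Ring R]

/-- The action on the opposite ring. -/
def MonoidHom.ringEndOp (τ : Γ →* (R →+* R)) : Γ →* (Rᵐᵒᵖ →+* Rᵐᵒᵖ) where
  toFun g := (τ g).op
  map_one' := by ext a; simp
  map_mul' g h := by ext a; simp

theorem hasInvariantForms_of_trace (τ : Γ →* (R →+* R)) {n : ℕ} (x : Fin n → R)
    (hx : ∀ y, (∀ i, ∑ g, τ g (y * x i) = 0) → y = 0) : HasInvariantForms τ := by
  refine ⟨n, fun i g => τ g (x i), fun i y h => ?_, fun y hy => hx y fun i => ?_⟩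
  · simp only [← map_mul]
    rw [map_sum, ← Equiv.sum_comp (Equiv.mulLeft h) fun g => τ g (y * x i)]
    exact Finset.sum_congr rfl fun g _ => (τ.ringEnd_mul_apply h g _).symm
  · simpa only [map_mul] using hy i

theorem IsPrimeLeftGoldie.hasInvariantForms_of_trace (hR : IsPrimeLeftGoldie Rᵐᵒᵖ)
    (τ : Γ →* (R →+* R)) (h : ∀ y, y ≠ 0 → ∃ x, ∑ g, τ g (y * x) ≠ 0) : HasInvariantForms τ := by
  obtain ⟨n, x, hx⟩ := hR.exists_finset_annihilating
    fun (x : R) (g : Γ) => MulOpposite.op (τ g x)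
  refine _root_.hasInvariantForms_of_trace τ x fun y hy => ?_
  by_contra hy0
  obtain ⟨z, hz⟩ := h y hy0
  have key : ∀ z, ∑ g, MulOpposite.op (τ g z) * MulOpposite.op (τ g y)
      = MulOpposite.op (∑ g, τ g (y * z)) := by
    intro z; rw [Finset.op_sum]; simp only [map_mul, MulOpposite.op_mul]
  have := hx (fun g => MulOpposite.op (τ g y)) (fun i => by rw [key, hy i]; rfl) z
  rw [key] at this
  exact hz (MulOpposite.op_injective this)

theorem IsPrimeLeftGoldie.hasInvariantForms_op_of_trace (hR : IsPrimeLeftGoldie R)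
    (τ : Γ →* (R →+* R)) (h : ∀ y, y ≠ 0 → ∃ x, ∑ g, τ g (x * y) ≠ 0) :
    HasInvariantForms τ.ringEndOp := by
  obtain ⟨n, x, hx⟩ := hR.exists_finset_annihilating fun (x : R) (g : Γ) => τ g x
  refine _root_.hasInvariantForms_of_trace _ (fun i => MulOpposite.op (x i)) fun y hy => ?_
  by_contra hy0
  obtain ⟨z, hz⟩ := h y.unop fun h => hy0 (MulOpposite.unop_injective h)
  refine hz ?_
  have := hx (fun g => τ g y.unop) (fun i => ?_) z
  · simpa only [map_mul] using this
  · have := congrArg MulOpposite.unop (hy i)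
    rw [Finset.unop_sum] at this
    simpa [MonoidHom.ringEndOp] using this

/-- The left Ore condition in a left Goldie domain. -/
theorem IsPrimeLeftGoldie.exists_mul_eq_mul [NoZeroDivisors R] (hR : IsPrimeLeftGoldie R)
    (r s : R) (hs : s ≠ 0) : ∃ r' s', s' ≠ 0 ∧ s' * r = r' * s := by
  have := hR.prime.nontrivial
  by_cases hr : r = 0
  · exact ⟨0, 1, one_ne_zero, by simp [hr]⟩
  obtain ⟨x, hx0, hx⟩ := hR.isEssential_span_singleton
    (s := s) (fun x hx => (mul_eq_zero.1 hx).resolve_right hs) r hr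
  obtain ⟨r', h⟩ := Submodule.mem_span_singleton.1 hx
  exact ⟨r', x, fun h => hx0 (by rw [h, zero_mul]), h.symm⟩

theorem IsPrimeRing.noZeroDivisors [IsReduced R] (hR : IsPrimeRing R) : NoZeroDivisors R where
  eq_zero_or_eq_zero_of_mul_eq_zero {a b} hab := by
    have hsq : ∀ x : R, x * x = 0 → x = 0 := fun x hx =>
      IsReduced.eq_zero x ⟨2, by rw [pow_two, hx]⟩
    have hba : b * a = 0 := hsq _ (by rw [mul_assoc, ← mul_assoc a b a, hab, zero_mul, mul_zero])
    refine hR.eq_zero_or_eq_zero a b fun r => hsq _ ?_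
    rw [show a * r * b * (a * r * b) = a * r * (b * a) * (r * b) by simp only [mul_assoc], hba,
      mul_zero, zero_mul]

theorem IsPrimeGoldie.hasInvariantForms_of_isReduced [IsReduced R] (hR : IsPrimeGoldie R)
    (τ : Γ →* (R →+* R)) : HasInvariantForms τ ∧ HasInvariantForms τ.ringEndOp := by
  have := hR.prime.nontrivial
  have := hR.prime.noZeroDivisors
  have hl := hR.isPrimeLeftGoldie.exists_mul_eq_mul
  have hr := hR.isPrimeLeftGoldie_op.exists_mul_eq_mul
  refine ⟨hasInvariantForms_of_ore τ hl fun r s hs => ?_,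
    hasInvariantForms_of_ore _ hr fun r s hs => ?_⟩
  · obtain ⟨r', s', hs', h⟩ := hr (.op r) (.op s) fun h => hs (MulOpposite.op_injective h)
    exact ⟨r'.unop, s'.unop, fun h => hs' (MulOpposite.unop_injective h),
      congrArg MulOpposite.unop h⟩
  · obtain ⟨r', s', hs', h⟩ := hl r.unop s.unop fun h => hs (MulOpposite.unop_injective h)
    exact ⟨.op r', .op s', fun h => hs' (MulOpposite.op_injective h),
      MulOpposite.unop_injective h⟩

end InvariantForms

section Subalgebra

variable {k A : Type*} [Field k] [Ring A] [Algebra k A] (G : Subgroup (A ≃ₐ[k] A))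

/-- A group of algebra automorphisms as a group of ring endomorphisms. -/
def Subgroup.toRingEnd : G →* (A →+* A) where
  toFun g := ((g : A ≃ₐ[k] A) : A →+* A)
  map_one' := rfl
  map_mul' _ _ := rfl

variable {G}

theorem mem_fixedPoints_subalgebra {a : A} :
    a ∈ FixedPoints.subalgebra k A G ↔ ∀ g, G.toRingEnd g a = a := Iff.rfl

variable [Fintype G]

theorem hasInvariantForms_toRingEnd (hA : IsPrimeGoldie A)
    (hG : HasNondegenerateTrace k A G ∨ IsReduced A) :
    HasInvariantForms G.toRingEnd ∧ HasInvariantForms G.toRingEnd.ringEndOp := by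
  rcases hG with ⟨hGl, hGr⟩ | hred
  · refine ⟨hA.isPrimeLeftGoldie_op.hasInvariantForms_of_trace _ fun y hy => ?_,
      hA.isPrimeLeftGoldie.hasInvariantForms_op_of_trace _ fun y hy => ?_⟩
    · obtain ⟨a, ha, ha0⟩ := hGr (Submodule.span Aᵐᵒᵖ {y}) (by simpa using hy)
      obtain ⟨x, rfl⟩ := Submodule.mem_span_singleton.1 ha
      exact ⟨x.unop, ha0⟩
    · obtain ⟨a, ha, ha0⟩ := hGl (Submodule.span A {y}) (by simpa using hy)
      obtain ⟨x, rfl⟩ := Submodule.mem_span_singleton.1 ha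
      exact ⟨x, ha0⟩
  · exact hA.hasInvariantForms_of_isReduced _

/-- The ring embeds in a free left module of finite rank over the invariants. -/
theorem HasInvariantForms.exists_injective (h : HasInvariantForms G.toRingEnd) :
    ∃ (n : ℕ) (Φ : A →ₗ[FixedPoints.subalgebra k A G] (Fin n → FixedPoints.subalgebra k A G)),
      Function.Injective Φ := by
  obtain ⟨n, c, hc, h0⟩ := h
  refine ⟨n, LinearMap.pi fun i =>
    { toFun := fun y => ⟨∑ g, G.toRingEnd g y * c i g, fun h => hc i y h⟩
      map_add' := fun y z => Subtype.ext (by simp [add_mul, Finset.sum_add_distrib])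
      map_smul' := fun b y => Subtype.ext (by
        simp only [Subalgebra.smul_def, smul_eq_mul, map_mul, RingHom.id_apply,
          MulMemClass.coe_mul, Finset.mul_sum]
        refine Finset.sum_congr rfl fun g _ => ?_
        rw [mem_fixedPoints_subalgebra.1 b.2 g, mul_assoc]) }, ?_⟩
  rw [← LinearMap.ker_eq_bot, LinearMap.ker_eq_bot']
  exact fun y hy => h0 y fun i => congrArg Subtype.val (congrFun hy i)

/-- A power of the ring contains a dense free right module of finite positive rank over the
invariants: finitely many elements of the power are carried into it by right multiplication by one
left regular invariant. -/
theorem HasInvariantForms.exists_free_dense (h : HasInvariantForms G.toRingEnd.ringEndOp)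
    [Nontrivial A] (hB : IsPrimeLeftGoldie (FixedPoints.subalgebra k A G)ᵐᵒᵖ) :
    ∃ (r l : ℕ) (e : Fin l → Fin r → A), 0 < l ∧
      (∀ b : Fin l → FixedPoints.subalgebra k A G, (∀ i, ∑ j, e j i * b j = 0) → b = 0) ∧
      ∀ Z : Finset (Fin r → A), ∃ s : FixedPoints.subalgebra k A G, (∀ x, s * x = 0 → x = 0) ∧
        ∀ z ∈ Z, ∃ b : Fin l → FixedPoints.subalgebra k A G,
          ∀ i, z i * s = ∑ j, e j i * b j := by
  obtain ⟨n, c, hc, h0⟩ := h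
  let _ : Module (FixedPoints.subalgebra k A G)ᵐᵒᵖ A :=
    Module.compHom A (FixedPoints.subalgebra k A G).val.toRingHom.op
  have hsmul : ∀ (b : (FixedPoints.subalgebra k A G)ᵐᵒᵖ) (a : A), b • a = a * b.unop :=
    fun b a => rfl
  let Φ : A →ₗ[(FixedPoints.subalgebra k A G)ᵐᵒᵖ] (Fin n → (FixedPoints.subalgebra k A G)ᵐᵒᵖ) :=
    LinearMap.pi fun i =>
    { toFun := fun y => .op ⟨(∑ g, G.toRingEnd.ringEndOp g (.op y) * c i g).unop,
        fun h => congrArg MulOpposite.unop (hc i (.op y) h)⟩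
      map_add' := fun y z => MulOpposite.unop_injective (Subtype.ext (by
        simp [add_mul, Finset.sum_add_distrib]))
      map_smul' := fun b y => MulOpposite.unop_injective (Subtype.ext (by
        simp only [hsmul, MulOpposite.op_mul, map_mul, RingHom.id_apply, smul_eq_mul,
          MulOpposite.unop_mul, MulOpposite.unop_op, MulMemClass.coe_mul, Finset.unop_sum,
          Finset.sum_mul]
        refine Finset.sum_congr rfl fun g _ => ?_
        rw [mul_assoc]
        congr 2
        exact mem_fixedPoints_subalgebra.1 b.unop.2 g)) }
  have hΦ : Function.Injective Φ := by
    rw [← LinearMap.ker_eq_bot, LinearMap.ker_eq_bot']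
    intro y hy
    refine MulOpposite.op_injective (h0 (.op y) fun i => MulOpposite.unop_injective ?_)
    exact congrArg (fun b => ((MulOpposite.unop b : FixedPoints.subalgebra k A G) : A))
      (congrFun hy i)
  obtain ⟨r, l, e, hl, hfree, hdense⟩ := hB.exists_free_dense Φ hΦ
  refine ⟨r, l, e, hl, fun b hb => ?_, fun Z => ?_⟩
  · have := hfree (fun j => .op (b j)) (funext fun i => by
      simpa [Finset.sum_apply, hsmul] using hb i)
    exact funext fun j => MulOpposite.op_injective (congrFun this j)
  · obtain ⟨s, hs, hsZ⟩ := hdense.exists_regular hB Z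
    refine ⟨s.unop, fun x hx => MulOpposite.op_injective
      (hs (.op x) (MulOpposite.unop_injective hx)), fun z hz => ?_⟩
    obtain ⟨b, hb⟩ := (Submodule.mem_span_range_iff_exists_fun _).1 (hsZ z hz)
    refine ⟨fun j => (b j).unop, fun i => ?_⟩
    have := congrFun hb i
    simpa [Finset.sum_apply, hsmul] using this.symm

end Subalgebra

/-! ### Volume growth on modules -/

section Volume

variable {k R N N' : Type*} [Field k] [Ring R] [Algebra k R]
  [AddCommGroup N] [Module k N] [Module R N] [IsScalarTower k R N]
  [AddCommGroup N'] [Module k N'] [Module R N'] [IsScalarTower k R N']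

variable (N) in
/-- The volume difference inequality for `V` acting on a module `N`, with the exponent `e` in place
of `(d - 1) / d`. The exponent `e = 1` gives the inequality for `d = ∞`. -/
def VolumeInequality (V : Submodule k R) (e : ℝ) : Prop :=
  ∃ c : ℝ, 0 < c ∧ ∀ W : Submodule k N, Module.Finite k W → W ≠ ⊥ →
    (Module.finrank k W : ℝ) + c * (Module.finrank k W : ℝ) ^ e ≤
      (Module.finrank k (V • W : Submodule k N) : ℝ)

theorem finite_smul {V : Submodule k R} {W : Submodule k N} (hV : Module.Finite k V)
    (hW : Module.Finite k W) : Module.Finite k (V • W : Submodule k N) := by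
  rw [Module.Finite.iff_fg] at *
  have h : V • W = Submodule.map₂ (Algebra.lsmul k k N).toLinearMap V W := by
    refine le_antisymm (Submodule.smul_le.2 fun v hv w hw => ?_)
      (Submodule.map₂_le.2 fun v hv w hw => ?_)
    · exact Submodule.apply_mem_map₂ (Algebra.lsmul k k N).toLinearMap hv hw
    · exact Submodule.smul_mem_smul hv hw
  rw [h]
  exact hV.map₂ _ hW

theorem map_smul_eq_smul_map (f : N →ₗ[R] N') (V : Submodule k R) (W : Submodule k N) :
    (V • W).map (f.restrictScalars k) = V • W.map (f.restrictScalars k) := by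
  refine le_antisymm (Submodule.map_le_iff_le_comap.2 (Submodule.smul_le.2 fun v hv w hw => ?_))
    (Submodule.smul_le.2 ?_)
  · rw [Submodule.mem_comap, LinearMap.restrictScalars_apply, map_smul]
    exact Submodule.smul_mem_smul hv ⟨w, hw, rfl⟩
  · rintro v hv _ ⟨w, hw, rfl⟩
    exact ⟨v • w, Submodule.smul_mem_smul hv hw, by simp⟩

theorem finrank_map_of_injective {M M' : Type*} [AddCommGroup M] [Module k M] [AddCommGroup M']
    [Module k M'] (f : M →ₗ[k] M') (hf : Function.Injective f) (W : Submodule k M) :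
    Module.finrank k (W.map f) = Module.finrank k W :=
  (Submodule.equivMapOfInjective f hf W).symm.finrank_eq

theorem finrank_eq_finrank_map_add_finrank_comap_ker (f : N →ₗ[R] N') (W : Submodule k N)
    [Module.Finite k W] :
    Module.finrank k W = Module.finrank k (W.map (f.restrictScalars k)) +
      Module.finrank k (W.comap ((LinearMap.ker f).subtype.restrictScalars k)) := by
  rw [← LinearMap.finrank_range_add_finrank_ker ((f.restrictScalars k).domRestrict W),
    LinearMap.range_domRestrict]
  congr 1
  rw [← Submodule.finrank_map_subtype_eq,
    ← finrank_map_of_injective _ (show Function.Injective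
      ((LinearMap.ker f).subtype.restrictScalars k) from Subtype.val_injective)]
  refine congrArg (fun U : Submodule k N => Module.finrank k U) ?_
  ext x
  simp only [Submodule.mem_map, Submodule.mem_comap]
  constructor
  · rintro ⟨w, hw, rfl⟩
    exact ⟨⟨w, hw⟩, w.2, rfl⟩
  · rintro ⟨y, hy, rfl⟩
    exact ⟨⟨y.1, hy⟩, y.2, rfl⟩

theorem VolumeInequality.of_injective {V : Submodule k R} {e : ℝ} (f : N →ₗ[R] N')
    (hf : Function.Injective f) (h : VolumeInequality N' V e) : VolumeInequality N V e := by
  obtain ⟨c, hc, H⟩ := h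
  have hf' : Function.Injective (f.restrictScalars k) := hf
  refine ⟨c, hc, fun W hW hW0 => ?_⟩
  have := H (W.map (f.restrictScalars k)) inferInstance
    (fun h => hW0 (Submodule.map_injective_of_injective hf' (h.trans (Submodule.map_bot _).symm)))
  rwa [← map_smul_eq_smul_map, finrank_map_of_injective _ hf',
    finrank_map_of_injective _ hf'] at this

omit [Module k N'] [IsScalarTower k R N'] in
theorem finite_comap_ker_subtype (f : N →ₗ[R] N') (W : Submodule k N) [Module.Finite k W] :
    Module.Finite k (W.comap ((LinearMap.ker f).subtype.restrictScalars k)) := by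
  refine Module.Finite.of_injective
    (((LinearMap.ker f).subtype.restrictScalars k).restrict (q := W) fun x hx => hx) ?_
  intro x y hxy
  exact Subtype.ext (Subtype.ext (congrArg (fun w : W => (w : N)) hxy))

theorem finrank_le_and_add_le_of_volume {V : Submodule k R} {c e a n : ℝ} (hc : 0 < c)
    (H : ∀ W : Submodule k N, Module.Finite k W → W ≠ ⊥ →
      (Module.finrank k W : ℝ) + c * (Module.finrank k W : ℝ) ^ e ≤
        (Module.finrank k (V • W : Submodule k N) : ℝ)) (W : Submodule k N) [Module.Finite k W]
    (hn : 0 < n) (ha : n / 2 ≤ Module.finrank k W → a ≤ c * (Module.finrank k W : ℝ) ^ e) :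
    (Module.finrank k W : ℝ) ≤ Module.finrank k (V • W : Submodule k N) ∧
      (n / 2 ≤ Module.finrank k W →
        Module.finrank k W + a ≤ Module.finrank k (V • W : Submodule k N)) := by
  by_cases h0 : W = ⊥
  · subst h0
    simp only [finrank_bot, Nat.cast_zero]
    exact ⟨Nat.cast_nonneg _, fun h => by linarith⟩
  · have := H W inferInstance h0
    exact ⟨le_trans (le_add_of_nonneg_right (by positivity)) this,
      fun h => le_trans (by linarith [ha h]) this⟩

theorem min_mul_rpow_le_rpow {p n : ℝ} (e : ℝ) (hn : 0 < n) (h1 : n / 2 ≤ p) (h2 : p ≤ n) :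
    min 1 ((1 / 2) ^ e) * n ^ e ≤ p ^ e := by
  have hp : 0 < p := by linarith
  rcases le_total 0 e with he | he
  · calc min 1 ((1 / 2) ^ e) * n ^ e ≤ (1 / 2) ^ e * n ^ e := by gcongr; exact min_le_right _ _
      _ = (n / 2) ^ e := by rw [← Real.mul_rpow (by norm_num) hn.le]; congr 1; ring
      _ ≤ p ^ e := Real.rpow_le_rpow (by linarith) h1 he
  · calc min 1 ((1 / 2) ^ e) * n ^ e ≤ 1 * n ^ e := by gcongr; exact min_le_left _ _
      _ = n ^ e := one_mul _
      _ ≤ p ^ e := Real.rpow_le_rpow_of_nonpos hp h2 he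

/-- Volume inequalities pass to extensions. One of the two parts of a subspace has at least half of
its dimension. -/
theorem VolumeInequality.of_ker {V : Submodule k R} (hV : Module.Finite k V) {e : ℝ}
    (f : N →ₗ[R] N') (h : VolumeInequality N' V e) (hK : VolumeInequality (LinearMap.ker f) V e) :
    VolumeInequality N V e := by
  obtain ⟨c₁, hc₁, H₁⟩ := h
  obtain ⟨c₂, hc₂, H₂⟩ := hK
  set q : ℝ := min 1 ((1 / 2) ^ e) with hq
  have hq0 : 0 < q := lt_min one_pos (Real.rpow_pos_of_pos (by norm_num) _)
  refine ⟨min c₁ c₂ * q, by positivity, fun W hW hW0 => ?_⟩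
  set W₁ := W.map (f.restrictScalars k) with hW₁
  set W₂ := W.comap ((LinearMap.ker f).subtype.restrictScalars k) with hW₂
  have hW₂f : Module.Finite k W₂ := finite_comap_ker_subtype f W
  have hVW := finite_smul hV hW
  have hdim := finrank_eq_finrank_map_add_finrank_comap_ker f W
  have hdimV := finrank_eq_finrank_map_add_finrank_comap_ker f (V • W)
  rw [map_smul_eq_smul_map] at hdimV
  have hle : Module.finrank k (V • W₂ : Submodule k (LinearMap.ker f)) ≤
      Module.finrank k ((V • W).comap ((LinearMap.ker f).subtype.restrictScalars k)) := by
    have := finite_comap_ker_subtype f (V • W)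
    exact Submodule.finrank_mono (Submodule.smul_le.2 fun v hv w hw =>
      Submodule.smul_mem_smul (N := W) hv hw)
  rw [← hW₁, ← hW₂] at hdim
  rw [← hW₁] at hdimV
  have hpos : 0 < Module.finrank k W := by
    have : Nontrivial W := Submodule.nontrivial_iff_ne_bot.2 hW0
    exact Module.finrank_pos
  have hposR : (0 : ℝ) < Module.finrank k W := by exact_mod_cast hpos
  have hdimR : (Module.finrank k W : ℝ) = Module.finrank k W₁ + Module.finrank k W₂ := by
    exact_mod_cast hdim
  have hVR : (Module.finrank k (V • W₁ : Submodule k N') : ℝ) +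
      Module.finrank k (V • W₂ : Submodule k (LinearMap.ker f)) ≤
      Module.finrank k (V • W : Submodule k N) := by
    rw [hdimV]; exact_mod_cast Nat.add_le_add_left hle _
  have hmin : ∀ c, min c₁ c₂ ≤ c → ∀ p : ℝ, (Module.finrank k W : ℝ) / 2 ≤ p →
      p ≤ Module.finrank k W →
      min c₁ c₂ * q * (Module.finrank k W : ℝ) ^ e ≤ c * p ^ e := by
    intro c hc p hp1 hp2
    rw [mul_assoc]
    exact mul_le_mul hc (min_mul_rpow_le_rpow e hposR hp1 hp2) (by positivity)
      (le_trans (by positivity) hc)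
  have h₁ := finrank_le_and_add_le_of_volume hc₁ H₁ W₁ hposR
    fun h => hmin c₁ (min_le_left _ _) _ h (by rw [hdimR]; simp)
  have h₂ := finrank_le_and_add_le_of_volume hc₂ H₂ W₂ hposR
    fun h => hmin c₂ (min_le_right _ _) _ h (by rw [hdimR]; simp)
  rcases le_total ((Module.finrank k W : ℝ) / 2) (Module.finrank k W₁) with hh | hh
  · have := h₁.2 hh; have := h₂.1; linarith
  · have := h₂.2 (by linarith); have := h₁.1; linarith

theorem VolumeInequality.pi_fin {V : Submodule k R} (hV : Module.Finite k V) {e : ℝ}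
    (h : VolumeInequality N V e) (n : ℕ) : VolumeInequality (Fin n → N) V e := by
  induction n with
  | zero => exact ⟨1, one_pos, fun W _ hW => absurd (Subsingleton.elim _ _) hW⟩
  | succ n ih =>
    refine VolumeInequality.of_ker hV (LinearMap.proj (Fin.last n)) h ?_
    refine VolumeInequality.of_injective
      ((LinearMap.funLeft R N (Fin.castSucc (n := n))).comp (Submodule.subtype _)) ?_ ih
    rw [← LinearMap.ker_eq_bot, LinearMap.ker_eq_bot']
    rintro ⟨v, hv⟩ hv0
    ext i
    refine Fin.lastCases ?_ (fun i => ?_) i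
    · exact hv
    · exact congrFun hv0 i

end Volume

/-! ### Comparison of lower transcendence degrees -/

section Comparison

variable {k A : Type*} [Field k] [Ring A] [Algebra k A]

theorem vdiTop_iff_volumeInequality {V : Submodule k A} :
    VDITop k A V ↔ VolumeInequality A V 1 := by
  simp only [VDITop, VolumeInequality, Real.rpow_one]; rfl

theorem LD_le_LD_of_volumeInequality {A' : Type*} [Ring A'] [Algebra k A']
    (h : ∀ V : Submodule k A, IsSubframe k A V → ∃ V' : Submodule k A', IsSubframe k A' V' ∧
      ∀ e, VolumeInequality A V e → VolumeInequality A' V' e) : LD k A ≤ LD k A' := by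
  refine sSup_le_sSup ?_
  rintro e ⟨V, hV, he⟩
  obtain ⟨V', hV', H⟩ := h V hV
  refine ⟨V', hV', he.imp ?_ ?_⟩
  -- `VDI k A V d` is by definition the inequality with exponent `(d - 1) / d`.
  · rintro ⟨d, hd, hVd, rfl⟩
    exact ⟨d, hd, H _ hVd, rfl⟩
  · rintro ⟨hVt, rfl⟩
    exact ⟨vdiTop_iff_volumeInequality.2 (H _ (vdiTop_iff_volumeInequality.1 hVt)), rfl⟩

variable {B : Subalgebra k A}

theorem isSubframe_map {V : Submodule k B} (hV : IsSubframe k B V) :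
    IsSubframe k A (V.map B.val.toLinearMap) :=
  have := hV.1
  ⟨inferInstance, 1, hV.2, map_one B.val⟩

/-- The image in `A` of a subframe of `B` has the same volume inequalities, since `A` embeds in a
free left `B`-module of finite rank. -/
theorem LD_le_of_injective {n : ℕ} (Φ : A →ₗ[B] (Fin n → B)) (hΦ : Function.Injective Φ) :
    LD k B ≤ LD k A := by
  refine LD_le_LD_of_volumeInequality fun V hV => ⟨_, isSubframe_map hV, fun e he => ?_⟩
  obtain ⟨c, hc, H⟩ := (he.pi_fin hV.1 n).of_injective Φ hΦ
  refine ⟨c, hc, fun W hW hW0 => ?_⟩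
  have hVW : V.map B.val.toLinearMap • W = V • W := by
    refine le_antisymm (Submodule.smul_le.2 ?_) (Submodule.smul_le.2 fun v hv w hw => ?_)
    · rintro _ ⟨v, hv, rfl⟩ w hw
      exact Submodule.smul_mem_smul (I := V) (N := W) hv hw
    · exact Submodule.smul_mem_smul (I := V.map B.val.toLinearMap) (N := W) ⟨v, hv, rfl⟩ hw
  rw [hVW]
  exact H W hW hW0

/-- The subspace of vectors all of whose entries lie in a given subspace. -/
def vectorsIn (l : ℕ) (W : Submodule k B) : Submodule k (Fin l → B) :=
  LinearMap.range (W.subtype.compLeft (Fin l))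

theorem mem_vectorsIn {l : ℕ} {W : Submodule k B} {b : Fin l → B} :
    b ∈ vectorsIn l W ↔ ∀ j, b j ∈ W := by
  constructor
  · rintro ⟨w, rfl⟩ j; exact (w j).2
  · exact fun h => ⟨fun j => ⟨b j, h j⟩, rfl⟩

theorem finrank_vectorsIn {l : ℕ} {W : Submodule k B} [Module.Finite k W] :
    Module.finrank k (vectorsIn l W) = l * Module.finrank k W := by
  rw [vectorsIn, LinearMap.finrank_range_of_inj, Module.finrank_pi_fintype]
  · simp
  · intro u v h
    funext j
    exact Subtype.ext (congrFun h j)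

/-- Suppose that some power of `A` contains a dense free right `B`-module with basis `e`. For a
subframe `V` of `A` the elements `v • e j` are carried into this module by one left regular `s`, and
their coordinates span a subframe `V'` of `B`. For `W ⊆ B` the subspace `V (∑ j, e j s W)` lies in
`∑ j, e j V' W`, so that the volume inequality of `V` on the power of `A` gives that of `V'`. -/
theorem LD_le_of_free_dense {r l : ℕ} (e : Fin l → Fin r → A) (hl : 0 < l)
    (hfree : ∀ b : Fin l → B, (∀ i, ∑ j, e j i * b j = 0) → b = 0)
    (hdense : ∀ Z : Finset (Fin r → A), ∃ s : B, (∀ x, s * x = 0 → x = 0) ∧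
        ∀ z ∈ Z, ∃ b : Fin l → B, ∀ i, z i * s = ∑ j, e j i * b j) :
    LD k A ≤ LD k B := by
  classical
  let T : (Fin l → B) →ₗ[k] (Fin r → A) :=
    { toFun := fun b i => ∑ j, e j i * b j
      map_add' := fun b b' => by funext i; simp [mul_add, Finset.sum_add_distrib]
      map_smul' := fun a b => by funext i; simp [Finset.smul_sum] }
  have hT : Function.Injective T := by
    rw [← LinearMap.ker_eq_bot, LinearMap.ker_eq_bot']
    exact fun b hb => hfree b fun i => congrFun hb i
  refine LD_le_LD_of_volumeInequality fun V hV => ?_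
  obtain ⟨S, hS⟩ := Module.Finite.iff_fg.1 hV.1
  obtain ⟨s, hs, hsZ⟩ := hdense ((S ×ˢ Finset.univ).image fun p => p.1 • e p.2)
  have hβ : ∀ v ∈ S, ∀ j, ∃ b : Fin l → B, ∀ i, v * e j i * s = ∑ j', e j' i * b j' :=
    fun v hv j => hsZ (v • e j) (Finset.mem_image.2 ⟨(v, j), by simp [hv], rfl⟩)
  choose! β hβ using hβ
  let F : Finset B := insert 1 ((S ×ˢ (Finset.univ ×ˢ Finset.univ)).image
    fun p : A × Fin l × Fin l => β p.1 p.2.1 p.2.2)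
  have hFβ : ∀ v ∈ S, ∀ j j', β v j j' ∈ Submodule.span k (F : Set B) := fun v hv j j' =>
    Submodule.subset_span (Finset.mem_insert_of_mem (Finset.mem_image.2
      ⟨(v, j, j'), by simp [hv], rfl⟩))
  refine ⟨Submodule.span k F, ⟨Module.Finite.span_finset k F,
    Submodule.subset_span (Finset.mem_insert_self _ _)⟩, fun x hx => ?_⟩
  obtain ⟨c, hc, H⟩ := hx.pi_fin hV.1 r
  have hl' : (0 : ℝ) < l := by exact_mod_cast hl
  refine ⟨c * (l : ℝ) ^ x / l, by positivity, fun W hW hW0 => ?_⟩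
  set V' := Submodule.span k (F : Set B) with hV'
  have hVW : Module.Finite k (V' • W : Submodule k B) :=
    finite_smul (Module.Finite.span_finset k F) hW
  have hsinj : Function.Injective (LinearMap.mulLeft k s) := by
    rw [← LinearMap.ker_eq_bot, LinearMap.ker_eq_bot']
    exact fun x hx => hs x hx
  have hfr1 : Module.finrank k ((vectorsIn l (W.map (LinearMap.mulLeft k s))).map T)
      = l * Module.finrank k W := by
    rw [finrank_map_of_injective _ hT, finrank_vectorsIn, finrank_map_of_injective _ hsinj]
  have hfr2 : Module.finrank k ((vectorsIn l (V' • W)).map T)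
      = l * Module.finrank k (V' • W : Submodule k B) := by
    rw [finrank_map_of_injective _ hT, finrank_vectorsIn]
  have hpos : 0 < Module.finrank k W := by
    have : Nontrivial W := Submodule.nontrivial_iff_ne_bot.2 hW0
    exact Module.finrank_pos
  have hfin1 : Module.Finite k (vectorsIn l (W.map (LinearMap.mulLeft k s))) := by
    unfold vectorsIn; infer_instance
  have hfin2 : Module.Finite k (vectorsIn l (V' • W)) := by
    unfold vectorsIn; infer_instance
  have hle : V • (vectorsIn l (W.map (LinearMap.mulLeft k s))).map T ≤
      (vectorsIn l (V' • W)).map T := by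
    refine Submodule.smul_le.2 ?_
    rintro v hv _ ⟨b, hb, rfl⟩
    rw [SetLike.mem_coe, mem_vectorsIn] at hb
    choose w hw hwb using hb
    rw [← hS] at hv
    induction hv using Submodule.span_induction with
    | mem v hv =>
      refine ⟨fun j' => ∑ j, β v j j' * w j, mem_vectorsIn.2 fun j' => Submodule.sum_mem _
        fun j _ => Submodule.smul_mem_smul (I := V') (N := W) (hFβ v hv j j') (hw j), ?_⟩
      funext i
      simp only [T, LinearMap.coe_mk, AddHom.coe_mk, Pi.smul_apply, smul_eq_mul, Finset.mul_sum,
        AddSubmonoidClass.coe_finsetSum, MulMemClass.coe_mul]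
      rw [Finset.sum_comm]
      refine Finset.sum_congr rfl fun j _ => ?_
      rw [← hwb j, LinearMap.mulLeft_apply, MulMemClass.coe_mul, ← mul_assoc, ← mul_assoc,
        hβ v hv j i, Finset.sum_mul]
      exact Finset.sum_congr rfl fun j' _ => (mul_assoc _ _ _).symm
    | zero => rw [zero_smul]; exact Submodule.zero_mem _
    | add u v _ _ hu hv => rw [add_smul]; exact Submodule.add_mem _ hu hv
    | smul a v _ hv => rw [smul_assoc]; exact Submodule.smul_mem _ _ hv
  have h1 := H ((vectorsIn l (W.map (LinearMap.mulLeft k s))).map T) inferInstance fun h => by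
    rw [h, finrank_bot] at hfr1
    exact (Nat.mul_pos hl hpos).ne hfr1
  have h2 : (Module.finrank k (V • (vectorsIn l (W.map (LinearMap.mulLeft k s))).map T :
      Submodule k (Fin r → A)) : ℝ) ≤ l * Module.finrank k (V' • W : Submodule k B) := by
    exact_mod_cast (Submodule.finrank_mono hle).trans hfr2.le
  rw [hfr1] at h1
  push_cast at h1
  rw [Real.mul_rpow hl'.le (by positivity)] at h1
  have h3 := h1.trans h2
  refine le_of_mul_le_mul_left (le_trans (le_of_eq ?_) h3) hl'
  field_simp

end Comparison

/-! ### Comparison with the Gelfand-Kirillov dimension -/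

section GelfandKirillov

variable {k A : Type*} [Field k] [Ring A] [Algebra k A]

theorem GKdim_subalgebra_le (B : Subalgebra k A) : GKdim k B ≤ GKdim k A := by
  refine iSup₂_le fun V hV => ?_
  refine le_trans (le_of_eq ?_) (le_iSup₂ (V.map B.val.toLinearMap) (isSubframe_map hV))
  congr 1
  funext n
  rw [← Submodule.map_pow, finrank_map_of_injective _ Subtype.val_injective]

theorem add_one_rpow_le {d x : ℝ} (hd : 1 ≤ d) (hx : 1 ≤ x) :
    (x + 1) ^ d ≤ x ^ d + d * 2 ^ (d - 1) * x ^ (d - 1) := by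
  have hx1 : 0 < x + 1 := by linarith
  have h1 := one_add_mul_self_le_rpow_one_add (s := -(1 / (x + 1))) (p := d)
    (by rw [neg_le_neg_iff, div_le_one hx1]; linarith) hd
  have h2 : x ^ d = (x + 1) ^ d * (1 + -(1 / (x + 1))) ^ d := by
    rw [← Real.mul_rpow hx1.le]
    · congr 1; field_simp; ring
    · rw [← sub_eq_add_neg, sub_nonneg, div_le_one hx1]; linarith
  have h3 : (x + 1) ^ d = (x + 1) ^ (d - 1) * (x + 1) := by
    conv_lhs => rw [show d = d - 1 + 1 by ring, Real.rpow_add_one hx1.ne']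
  have h4 : (x + 1) ^ (d - 1) ≤ 2 ^ (d - 1) * x ^ (d - 1) := by
    rw [← Real.mul_rpow (by norm_num) (by linarith)]
    exact Real.rpow_le_rpow hx1.le (by linarith) (by linarith)
  have h5 : (x + 1) ^ d - d * (x + 1) ^ (d - 1) ≤ x ^ d := by
    rw [h2]
    refine le_trans (le_of_eq ?_) (mul_le_mul_of_nonneg_left h1 (by positivity))
    rw [h3]; field_simp; ring
  have h6 := mul_le_mul_of_nonneg_left h4 (by linarith : (0 : ℝ) ≤ d)
  linarith

/-- A sequence `x` with `x (n + 1) ≥ x n + c * x n ^ ((d - 1) / d)` grows at least like `n ^ d`. -/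
theorem exists_mul_rpow_le_of_step {x : ℕ → ℝ} {c d : ℝ} (hc : 0 < c) (hd : 1 ≤ d)
    (hx1 : ∀ n, 1 ≤ x n) (hx : ∀ n, x n + c * x n ^ ((d - 1) / d) ≤ x (n + 1)) :
    ∃ ε : ℝ, 0 < ε ∧ ∀ n : ℕ, (ε * n) ^ d ≤ x n := by
  have hd0 : 0 < d := by linarith
  -- With this choice the gain `c * (ε n) ^ (d - 1)` is at least the increment of `(ε n) ^ d`.
  set ε := min 1 (c / (d * 2 ^ (d - 1))) with hε
  have hq : (0 : ℝ) < d * 2 ^ (d - 1) := by positivity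
  have hε0 : 0 < ε := lt_min one_pos (by positivity)
  have hεc : ε * (d * 2 ^ (d - 1)) ≤ c := (le_div_iff₀ hq).1 (min_le_right _ _)
  refine ⟨ε, hε0, fun n => ?_⟩
  induction n with
  | zero => simp [Real.zero_rpow hd0.ne']; linarith [hx1 0]
  | succ n ih =>
    rcases Nat.eq_zero_or_pos n with rfl | hn
    · refine le_trans (Real.rpow_le_one (by positivity) ?_ hd0.le) (hx1 _)
      rw [zero_add, Nat.cast_one, mul_one]
      exact min_le_left _ _
    have hn' : (1 : ℝ) ≤ n := by exact_mod_cast hn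
    refine le_trans ?_ (hx n)
    have h1 : (ε * n) ^ (d - 1) ≤ x n ^ ((d - 1) / d) := by
      have : (ε * n) ^ (d - 1) = ((ε * n) ^ d) ^ ((d - 1) / d) := by
        rw [← Real.rpow_mul (by positivity)]; congr 1; field_simp
      rw [this]
      exact Real.rpow_le_rpow (by positivity) ih (div_nonneg (by linarith) hd0.le)
    have h2 := mul_le_mul_of_nonneg_left (add_one_rpow_le hd hn')
      (by positivity : (0 : ℝ) ≤ ε ^ d)
    have h3 : ε ^ d = ε ^ (d - 1) * ε := by
      conv_lhs => rw [show d = d - 1 + 1 by ring, Real.rpow_add_one hε0.ne']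
    push_cast
    calc (ε * (n + 1)) ^ d = ε ^ d * (n + 1) ^ d := Real.mul_rpow hε0.le (by positivity)
      _ ≤ ε ^ d * (n ^ d + d * 2 ^ (d - 1) * n ^ (d - 1)) := h2
      _ = (ε * n) ^ d + ε * (d * 2 ^ (d - 1)) * (ε * n) ^ (d - 1) := by
        rw [Real.mul_rpow hε0.le (by positivity), Real.mul_rpow hε0.le (by positivity), h3]; ring
      _ ≤ (ε * n) ^ d + c * (ε * n) ^ (d - 1) := by gcongr
      _ ≤ x n + c * x n ^ ((d - 1) / d) := by gcongr

open Filter Topology in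
theorem ofReal_le_limsup_log_div_log {x : ℕ → ℝ} {ε d : ℝ} (hε : 0 < ε)
    (hx : ∀ n : ℕ, (ε * n) ^ d ≤ x n) :
    ENNReal.ofReal d ≤
      limsup (fun n : ℕ => ENNReal.ofReal (Real.log (x n) / Real.log n)) atTop := by
  have hlog : Tendsto (fun n : ℕ => Real.log n) atTop atTop :=
    Real.tendsto_log_atTop.comp tendsto_natCast_atTop_atTop
  have hlim : Tendsto (fun n : ℕ => ENNReal.ofReal (d * (Real.log ε / Real.log n + 1))) atTop
      (𝓝 (ENNReal.ofReal d)) := by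
    refine ENNReal.tendsto_ofReal ?_
    have := ((hlog.const_div_atTop (Real.log ε)).add_const 1).const_mul d
    simpa using this
  rw [← hlim.limsup_eq]
  refine limsup_le_limsup ?_
  filter_upwards [eventually_gt_atTop 1] with n hn
  refine ENNReal.ofReal_le_ofReal ?_
  have hn' : (1 : ℝ) < n := by exact_mod_cast hn
  have hlogn : 0 < Real.log n := Real.log_pos hn'
  have hεn : 0 < ε * n := by positivity
  rw [le_div_iff₀ hlogn]
  refine le_trans (le_of_eq ?_) (Real.log_le_log (Real.rpow_pos_of_pos hεn d) (hx n))
  rw [Real.log_rpow hεn, Real.log_mul hε.ne' (by positivity)]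
  field_simp

theorem VDI.ofReal_le_GKdim [Nontrivial A] {V : Submodule k A} (hV : IsSubframe k A V) {d : ℝ}
    (hd : 0 < d) (h : VDI k A V d) : ENNReal.ofReal d ≤ GKdim k A := by
  obtain ⟨c, hc, H⟩ := h
  refine le_trans ?_ (le_iSup₂ V hV)
  let x : ℕ → ℝ := fun n => Module.finrank k (V ^ n : Submodule k A)
  have hfin : ∀ n, Module.Finite k (V ^ n : Submodule k A) := fun n =>
    Module.Finite.iff_fg.2 ((Module.Finite.iff_fg.1 hV.1).pow n)
  have hone : ∀ n, (1 : A) ∈ V ^ n := fun n => by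
    have := Submodule.pow_mem_pow V hV.2 n
    rwa [one_pow] at this
  have hbot : ∀ n, V ^ n ≠ ⊥ := fun n => (Submodule.ne_bot_iff _).2 ⟨1, hone n, one_ne_zero⟩
  have hx1 : ∀ n, 1 ≤ x n := fun n => by
    have : Nontrivial (V ^ n : Submodule k A) := Submodule.nontrivial_iff_ne_bot.2 (hbot n)
    exact Nat.one_le_cast.2 Module.finrank_pos
  have hstep : ∀ n, x n + c * x n ^ ((d - 1) / d) ≤ x (n + 1) := fun n => by
    have := H (V ^ n) (hfin n) (hbot n)
    rwa [← pow_succ'] at this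
  rcases le_total 1 d with hd1 | hd1
  · obtain ⟨ε, hε, hεx⟩ := exists_mul_rpow_le_of_step hc hd1 hx1 hstep
    exact ofReal_le_limsup_log_div_log hε hεx
  · -- For `d ≤ 1` it suffices that the dimensions increase strictly.
    refine ofReal_le_limsup_log_div_log one_pos fun n => ?_
    have hlt : ∀ n, Module.finrank k (V ^ n : Submodule k A) <
        Module.finrank k (V ^ (n + 1) : Submodule k A) := fun n => by
      have h1 : x n < x (n + 1) := by
        have := mul_pos hc (Real.rpow_pos_of_pos (lt_of_lt_of_le one_pos (hx1 n)) ((d - 1) / d))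
        linarith [hstep n]
      exact Nat.cast_lt.1 h1
    have hn : (n : ℝ) ≤ x n := Nat.cast_le.2 (strictMono_nat_of_lt_succ hlt).le_apply
    rw [one_mul]
    rcases Nat.eq_zero_or_pos n with rfl | hpos
    · rw [Nat.cast_zero, Real.zero_rpow hd.ne']
      linarith [hx1 0]
    · refine le_trans ?_ hn
      have hn1 : (1 : ℝ) ≤ n := by exact_mod_cast hpos
      simpa using Real.rpow_le_rpow_of_exponent_le hn1 hd1

theorem VDITop.vdi {V : Submodule k A} (h : VDITop k A V) {d : ℝ} (hd : 0 < d) : VDI k A V d := by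
  obtain ⟨c, hc, H⟩ := h
  refine ⟨c, hc, fun W hW hW0 => le_trans ?_ (H W hW hW0)⟩
  have : Nontrivial W := Submodule.nontrivial_iff_ne_bot.2 hW0
  have h1 : (1 : ℝ) ≤ Module.finrank k W := by
    exact_mod_cast (Module.finrank_pos : 0 < Module.finrank k W)
  have h2 : (Module.finrank k W : ℝ) ^ ((d - 1) / d) ≤ Module.finrank k W := by
    simpa using Real.rpow_le_rpow_of_exponent_le h1
      (show (d - 1) / d ≤ 1 by rw [div_le_one hd]; linarith)
  gcongr

/-- Nontriviality matters: on the zero ring every volume difference inequality holds vacuously, so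
that `LD` is infinite there. -/
theorem LD_le_GKdim [Nontrivial A] : LD k A ≤ GKdim k A := by
  refine sSup_le ?_
  rintro e ⟨V, hV, ⟨d, hd, h, rfl⟩ | ⟨h, rfl⟩⟩
  · exact h.ofReal_le_GKdim hV hd
  · refine ENNReal.le_of_forall_nnreal_lt fun r _ => ?_
    refine le_trans ?_ ((h.vdi (d := r + 1) (by positivity)).ofReal_le_GKdim hV (by positivity))
    rw [← ENNReal.ofReal_coe_nnreal]
    exact ENNReal.ofReal_le_ofReal (by linarith)

end GelfandKirillov

theorem theorem4p4 {k : Type*} [Field k] {A : Type*} [Ring A] [Algebra k A]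
    (G : Subgroup (A ≃ₐ[k] A)) [Fintype G]
    (hA : IsPrimeGoldie A)
    (hG : HasNondegenerateTrace k A G ∨ IsReduced A)
    (hB : IsPrimeGoldie (FixedPoints.subalgebra k A G)) :
    LD k A = LD k (FixedPoints.subalgebra k A G) ∧
      (IsLDStable k A → IsLDStable k (FixedPoints.subalgebra k A G)) := by
  have := hA.prime.nontrivial
  have := hB.prime.nontrivial
  obtain ⟨hl, hr⟩ := hasInvariantForms_toRingEnd hA hG
  obtain ⟨n, Φ, hΦ⟩ := hl.exists_injective
  obtain ⟨r, l, e, hl0, hfree, hdense⟩ := hr.exists_free_dense hB.isPrimeLeftGoldie_op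
  have hLD : LD k A = LD k (FixedPoints.subalgebra k A G) :=
    le_antisymm (LD_le_of_free_dense e hl0 hfree hdense) (LD_le_of_injective Φ hΦ)
  refine ⟨hLD, fun hst => le_antisymm LD_le_GKdim ?_⟩
  exact (GKdim_subalgebra_le _).trans (hst.symm.le.trans hLD.le)
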